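/- Let $\mathsf X=\{1,2,3,4\}$, $\sigma=(12)(34)$, $\pi=(13)(24)$, and let $\Gamma=\langle\alpha,\beta,\gamma,a,b,c\rangle$ be the group of automorphisms of the rooted tree $\mathsf X^*$ of finite words over $\mathsf X$ generated by the automorphisms defined recursively by $$\alpha=\sigma,\quad \beta=(\alpha,\gamma,\alpha,\gamma),\quad \gamma=(\beta,\varepsilon,\varepsilon,\beta),\quad a=\pi,\quad b=(a\alpha,a\alpha,c,c),\quad c=(b\beta,b\beta,b,b),$$ where $g=\tau(g_1,g_2,g_3,g_4)$ means $g(xv)=\tau(x)\,g_x(v)$ for $x\in\mathsf X$, $v\in\mathsf X^*$; we write $g(x)=\tau(x)$, $g|_x=g_x$, and $\varepsilon$ is the identity. Products are compositions of left actions, $(gh)(v)=g(h(v))$. Let $$\mathfrak A=\{\alpha,\beta,\gamma,a,b,c,a\alpha,b\beta,c\gamma,a\alpha\gamma,\alpha c,\varepsilon\}\subset\Gamma .$$ Let $\mathfrak M=\mathsf X\times\Gamma$ be the $\Gamma$-bimodule with $(x,h)\cdot g=(x,hg)$ and $g\cdot(x,h)=(g(x),g|_xh)$, where $x\in\mathsf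 X$ is identified with $(x,\varepsilon)$. For a right $\Gamma$-space (or bimodule) $Y$ and a $\Gamma$-bimodule $M$, regarded as a discrete space, $Y\otimes M$ is the topological quotient of $Y\times M$ by $(y\cdot g,m)\sim(y,g\cdot m)$, with $\Gamma$ acting on the right by $(y\otimes m)\cdot g=y\otimes(m\cdot g)$; $\mathfrak M^{\otimes n}$ is the $n$-th tensor power, with $\mathfrak M^{\otimes 0}=\Gamma$. Let $\mathcal G$ be the set of the six subgroups $$\langle\beta,\gamma,b,c\rangle,\ \langle\alpha,\gamma,a,c\rangle,\ \langle\alpha,\beta,a,b\rangle,\ \langle\alpha,b,c\rangle,\ \langle\beta,a,c\gamma\rangle,\ \langle\gamma,a\alpha,b\beta\rangle$$ of $\Gamma$ and of all their pairwise and triple intersections. Let $\Xi$ be the geometric realization of the order complex of the set $\{G\cdot g: G\in\mathcal G,\ g\in\Gamma\}$ ordered by inclusion, with $\Gamma$ acting by right translations, and let $\mathcal T_0\subset\Xi$ be the subcomplex spanned by the vertices $G\in\mathcal G$. For $n\ge0$ put $\Xi_n=\Xi\otimes\mathfrak M^{\otimes n}$ and $$\mathcal T_n=\{\xi\otimes x_1\otimes\cdots\otimes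 x_n:\ \xi\in\mathcal T_0,\ x_i\in\mathsf X\}\subset\Xi_n$$ with the subspace topology. For $g\in\Gamma$ let $K_{g,n}=\mathcal T_n\cap\mathcal T_n\cdot g$ and $\kappa_{g,n}:K_{g,n}\to K_{g^{-1},n}$, $\kappa_{g,n}(\xi)=\xi\cdot g^{-1}$. **Theorem.** Let $n\ge 0$. 1. The map $\mathcal T_n\times\mathsf X\to\mathcal T_{n+1}$, $(\xi,x)\mapsto\xi\otimes x$, is a topological quotient map, and two points have the same image if and only if they are equivalent under the equivalence relation on $\mathcal T_n\times\mathsf X$ generated by the identifications $(\xi,x)\sim(\kappa_{g,n}(\xi),g(x))$ for all $g\in\mathfrak A$, $x\in\mathsf X$, $\xi\in K_{g,n}$ such that $g|_x=\varepsilon$. 2. For every $g\in\mathfrak A$, $$K_{g,n+1}=\bigcup_{h\in\mathfrak A,\ x\in\mathsf X,\ h|_x=g}K_{h,n}\otimes x .$$ 3. For every $g\in\mathfrak A$ one has $K_{g^{-1},n+1}=K_{g,n+1}$, and the map $\kappa_{g,n+1}:K_{g,n+1}\to K_{g,n+1}$ acts by the rule $$\kappa_{g,n+1}(\xi\otimes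 x)=\kappa_{h,n}(\xi)\otimes h(x)$$ for all $h\in\mathfrak A$, $x\in\mathsf X$ and $\xi\in K_{h,n}$ such that $h|_x=g$. -/

import Mathlib

namespace Pasting

open MulOpposite

/-! ### Tensor products over a group

A right `G`-action is an action of `Gᵐᵒᵖ`; `op g • y` is `y · g`. -/

section Tensor

variable (G : Type) [Group G] (Y M : Type)

/-- The identifications `(y · g, m) ∼ (y, g · m)` on `Y × M`. -/
def tensorSetoid [MulAction Gᵐᵒᵖ Y] [MulAction G M] : Setoid (Y × M) where
  r p q := ∃ g : G, p.1 = op g • q.1 ∧ q.2 = g • p.2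
  iseqv :=
    { refl := fun p => ⟨1, by simp, by simp⟩
      symm := by
        rintro p q ⟨g, h1, h2⟩
        exact ⟨g⁻¹, by rw [h1, smul_smul, ← op_mul]; simp, by rw [h2, smul_smul]; simp⟩
      trans := by
        rintro p q r ⟨g, h1, h2⟩ ⟨k, h3, h4⟩
        exact ⟨k * g, by rw [h1, h3, smul_smul, ← op_mul], by rw [h4, h2, smul_smul]⟩ }

/-- The tensor product `Y ⊗ M` of a right `G`-set and a left `G`-set. -/
def Tensor [MulAction Gᵐᵒᵖ Y] [MulAction G M] : Type :=
  Quotient (tensorSetoid G Y M)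

variable {Y M}

/-- The element `y ⊗ m`. -/
def tmul [MulAction Gᵐᵒᵖ Y] [MulAction G M] (y : Y) (m : M) : Tensor G Y M :=
  Quotient.mk (tensorSetoid G Y M) (y, m)

/-- The quotient topology on `Y ⊗ M`, where `M` is discrete. -/
instance [MulAction Gᵐᵒᵖ Y] [MulAction G M] [TopologicalSpace Y] :
    TopologicalSpace (Tensor G Y M) :=
  TopologicalSpace.coinduced (fun p : Y × M => tmul G p.1 p.2)
    (@instTopologicalSpaceProd Y M _ ⊥)

/-- The right action `(y ⊗ m) · g = y ⊗ (m · g)`. -/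
instance [MulAction Gᵐᵒᵖ Y] [MulAction G M] [MulAction Gᵐᵒᵖ M] [SMulCommClass G Gᵐᵒᵖ M] :
    MulAction Gᵐᵒᵖ (Tensor G Y M) where
  smul g := Quotient.map (fun p => (p.1, g • p.2)) (by
    rintro p q ⟨k, h1, h2⟩
    exact ⟨k, h1, by simp only [h2]; exact (smul_comm k g p.2).symm⟩)
  one_smul := by
    rintro ⟨p⟩
    exact congrArg (Quotient.mk _) (Prod.ext rfl (one_smul _ p.2))
  mul_smul := by
    rintro g k ⟨p⟩
    exact congrArg (Quotient.mk _) (Prod.ext rfl (mul_smul g k p.2))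

/-- The left action `g · (y ⊗ m) = (g · y) ⊗ m`. -/
instance [MulAction Gᵐᵒᵖ Y] [MulAction G Y] [SMulCommClass G Gᵐᵒᵖ Y] [MulAction G M] :
    MulAction G (Tensor G Y M) where
  smul g := Quotient.map (fun p => (g • p.1, p.2)) (by
    rintro p q ⟨k, h1, h2⟩
    exact ⟨k, by simp only [h1]; exact smul_comm g (op k) q.1, h2⟩)
  one_smul := by
    rintro ⟨p⟩
    exact congrArg (Quotient.mk _) (Prod.ext (one_smul _ p.1) rfl)
  mul_smul := by
    rintro g k ⟨p⟩
    exact congrArg (Quotient.mk _) (Prod.ext (mul_smul g k p.1) rfl)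

instance [MulAction Gᵐᵒᵖ Y] [MulAction G Y] [SMulCommClass G Gᵐᵒᵖ Y]
    [MulAction G M] [MulAction Gᵐᵒᵖ M] [SMulCommClass G Gᵐᵒᵖ M] :
    SMulCommClass G Gᵐᵒᵖ (Tensor G Y M) where
  smul_comm := by
    rintro g k ⟨p⟩
    rfl

/-- A permutational `G`-bimodule. -/
structure Bimodule where
  carrier : Type
  [left : MulAction G carrier]
  [right : MulAction Gᵐᵒᵖ carrier]
  [comm : SMulCommClass G Gᵐᵒᵖ carrier]

attribute [instance] Bimodule.left Bimodule.right Bimodule.comm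

variable {G}

/-- The tensor power `M^{⊗ n}`; the power `n = 0` is the group `G` as a bimodule over itself. -/
def Bimodule.pow (B : Bimodule G) : ℕ → Bimodule G
  | 0 => ⟨G⟩
  | n + 1 => ⟨Tensor G (B.pow n).carrier B.carrier⟩

end Tensor

/-! ### The group `Γ` generated by the automaton -/

/-- The alphabet; the letters `1, 2, 3, 4` are `0, 1, 2, 3`. -/
abbrev X : Type := Fin 4

/-- Names of the twelve states `ε, α, β, γ, a, b, c, aα, bβ, cγ, aαγ, αc`. -/
inductive St : Type
  | one | al | be | ga | a | b | c | aal | bbe | cga | aalga | alc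

namespace St

/-- The permutation of the alphabet at a state: `σ = (12)(34)`, `π = (13)(24)` or `πσ = (14)(23)`
or the identity. -/
def out : St → X → X
  | al | alc => ![1, 0, 3, 2]
  | a => ![2, 3, 0, 1]
  | aal | aalga => ![3, 2, 1, 0]
  | one | be | ga | b | c | bbe | cga => ![0, 1, 2, 3]

/-- The sections of a state at the four letters. -/
def next : St → X → St
  | one | al | a | aal => ![one, one, one, one]
  | be => ![al, ga, al, ga]
  | ga | aalga => ![be, one, one, be]
  | b => ![aal, aal, c, c]
  | c | alc => ![bbe, bbe, b, b]
  | bbe => ![a, aalga, alc, cga]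
  | cga => ![b, bbe, b, bbe]

/-- The transformation of words defined by a state: read `x`, write `out q x`, pass to the
state `next q x`. -/
def run : St → List X → List X
  | _, [] => []
  | q, x :: v => q.out x :: run (q.next x) v

theorem run_involutive (q : St) : Function.Involutive q.run := by
  intro v
  induction v generalizing q with
  | nil => rfl
  | cons x v ih =>
    have h1 : q.out (q.out x) = x := by cases q <;> revert x <;> decide
    have h2 : q.next (q.out x) = q.next x := by cases q <;> fin_cases x <;> rfl
    simp only [run, h1, h2, ih]

/-- The permutation of the set of words over `X` defined by a state. -/
def perm (q : St) : Equiv.Perm (List X) := (run_involutive q).toPerm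

theorem run_one (v : List X) : run one v = v := by
  induction v with
  | nil => rfl
  | cons x v ih => fin_cases x <;> simp [run, out, next, ih]

theorem run_aal (v : List X) : run aal v = run a (run al v) := by
  cases v with
  | nil => rfl
  | cons x v => fin_cases x <;> simp [run, out, next, run_one]

theorem run_aalga (v : List X) : run aalga v = run a (run al (run ga v)) := by
  cases v with
  | nil => rfl
  | cons x v => fin_cases x <;> simp [run, out, next, run_one]

theorem run_alc (v : List X) : run alc v = run al (run c v) := by
  cases v with
  | nil => rfl
  | cons x v => fin_cases x <;> simp [run, out, next, run_one]

theorem run_alc' (v : List X) : run alc v = run c (run al v) := by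
  cases v with
  | nil => rfl
  | cons x v => fin_cases x <;> simp [run, out, next, run_one]

theorem run_bbe_cga (v : List X) :
    (run bbe v = run b (run be v) ∧ run bbe (run be v) = run b v) ∧
    (run cga v = run c (run ga v) ∧ run cga (run ga v) = run c v) := by
  induction v with
  | nil => exact ⟨⟨rfl, rfl⟩, rfl, rfl⟩
  | cons x v ih =>
    obtain ⟨⟨h1, h2⟩, h3, h4⟩ := ih
    have i1 := run_involutive al
    have i2 := run_involutive be
    have i3 := run_involutive ga
    refine ⟨⟨?_, ?_⟩, ?_, ?_⟩ <;> fin_cases x <;>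
      simp [run, out, next, run_one, run_aal, run_aalga, run_alc', i1 _, i3 _, h1, h3] <;>
      first
      | exact h2
      | exact h2.symm
      | exact h4

end St

/-- The group `Γ` of automorphisms of the tree of words over `X` generated by
`α = σ`, `β = (α, γ, α, γ)`, `γ = (β, ε, ε, β)`,
`a = π`, `b = (aα, aα, c, c)`, `c = (bβ, bβ, b, b)`. -/
def Gam : Subgroup (Equiv.Perm (List X)) :=
  Subgroup.closure
    {St.al.perm, St.be.perm, St.ga.perm, St.a.perm, St.b.perm, St.c.perm}

/-- The group `Γ` as a type. -/
abbrev Γ : Type := Gam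

namespace Γ

def al : Γ := ⟨St.al.perm, Subgroup.subset_closure (by simp)⟩
def be : Γ := ⟨St.be.perm, Subgroup.subset_closure (by simp)⟩
def ga : Γ := ⟨St.ga.perm, Subgroup.subset_closure (by simp)⟩
def a : Γ := ⟨St.a.perm, Subgroup.subset_closure (by simp)⟩
def b : Γ := ⟨St.b.perm, Subgroup.subset_closure (by simp)⟩
def c : Γ := ⟨St.c.perm, Subgroup.subset_closure (by simp)⟩

end Γ

open Γ

/-- The state set `𝔄 = {α, β, γ, a, b, c, aα, bβ, cγ, aαγ, αc, ε}` of the automaton. -/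
def Aut12 : Set Γ :=
  {al, be, ga, a, b, c, a * al, b * be, c * ga, a * al * ga, al * c, 1}

/-- The element of `Γ` with a given name. -/
def St.elt : St → Γ
  | one => 1
  | al => Γ.al
  | be => Γ.be
  | ga => Γ.ga
  | a => Γ.a
  | b => Γ.b
  | c => Γ.c
  | aal => Γ.a * Γ.al
  | bbe => Γ.b * Γ.be
  | cga => Γ.c * Γ.ga
  | aalga => Γ.a * Γ.al * Γ.ga
  | alc => Γ.al * Γ.c

theorem St.elt_apply (q : St) (v : List X) : (q.elt : Equiv.Perm (List X)) v = q.run v := by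
  cases q
  case one => exact (run_one v).symm
  case aal => exact (run_aal v).symm
  case bbe => exact (run_bbe_cga v).1.1.symm
  case cga => exact (run_bbe_cga v).2.1.symm
  case aalga => exact (run_aalga v).symm
  case alc => exact (run_alc v).symm
  all_goals rfl

theorem exists_wreath (g : Γ) :
    ∃ (σ : Equiv.Perm X) (s : X → Γ),
      (g : Equiv.Perm (List X)) [] = [] ∧
      ∀ x v, (g : Equiv.Perm (List X)) (x :: v) = σ x :: (s x : Equiv.Perm (List X)) v := by
  obtain ⟨g, hg⟩ := g
  have key : ∀ q : St, ∃ (σ : Equiv.Perm X) (s : X → Γ), q.perm [] = [] ∧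
      ∀ x v, q.perm (x :: v) = σ x :: (s x : Equiv.Perm (List X)) v := fun q =>
    ⟨Function.Involutive.toPerm q.out (by intro x; cases q <;> revert x <;> decide),
      fun x => (q.next x).elt, rfl, fun x v => by rw [St.elt_apply]; rfl⟩
  refine Subgroup.closure_induction (p := fun g _ => ∃ (σ : Equiv.Perm X) (s : X → Γ),
    g [] = [] ∧ ∀ x v, g (x :: v) = σ x :: (s x : Equiv.Perm (List X)) v) ?_ ?_ ?_ ?_ hg
  · rintro g (rfl | rfl | rfl | rfl | rfl | rfl) <;> exact key _
  · exact ⟨1, fun _ => 1, rfl, fun _ _ => rfl⟩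
  · rintro g h _ _ ⟨σ, s, h0, h1⟩ ⟨τ, t, h2, h3⟩
    exact ⟨σ * τ, fun x => s (τ x) * t x, by simp [h0, h2], fun x v => by simp [h1, h3]⟩
  · rintro g _ ⟨σ, s, h0, h1⟩
    refine ⟨σ⁻¹, fun x => (s (σ⁻¹ x))⁻¹, ?_, fun x v => ?_⟩
    · rw [Equiv.Perm.inv_eq_iff_eq, h0]
    · rw [Equiv.Perm.inv_eq_iff_eq, h1]; simp

/-- The permutation `x ↦ g(x)` of the alphabet defined by `g ∈ Γ`. -/
noncomputable def letter (g : Γ) : Equiv.Perm X := (exists_wreath g).choose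

/-- The section `g|_x`. -/
noncomputable def sec (g : Γ) : X → Γ := (exists_wreath g).choose_spec.choose

/-- The defining property `g(xv) = g(x) g|_x(v)`. -/
theorem apply_cons (g : Γ) (x : X) (v : List X) :
    (g : Equiv.Perm (List X)) (x :: v) = letter g x :: (sec g x : Equiv.Perm (List X)) v :=
  (exists_wreath g).choose_spec.choose_spec.2 x v

theorem apply_nil (g : Γ) : (g : Equiv.Perm (List X)) [] = [] :=
  (exists_wreath g).choose_spec.choose_spec.1

theorem wreath_unique {g s : Γ} {x y : X}
    (h : ∀ v, (g : Equiv.Perm (List X)) (x :: v) = y :: (s : Equiv.Perm (List X)) v) :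
    letter g x = y ∧ sec g x = s := by
  have h' := fun v => (apply_cons g x v).symm.trans (h v)
  exact ⟨(List.cons.inj (h' [])).1, Subtype.ext (Equiv.ext fun v => (List.cons.inj (h' v)).2)⟩

theorem wreath_elt (q : St) (x : X) :
    letter q.elt x = q.out x ∧ sec q.elt x = (q.next x).elt :=
  wreath_unique fun v => by rw [St.elt_apply, St.elt_apply]; rfl

theorem wreath_one (x : X) : letter 1 x = x ∧ sec 1 x = 1 := wreath_unique fun _ => rfl

theorem wreath_mul (g h : Γ) (x : X) :
    letter (g * h) x = letter g (letter h x) ∧ sec (g * h) x = sec g (letter h x) * sec h x :=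
  wreath_unique fun v => by simp [apply_cons]

/-- The wreath recursion of the generators. -/
theorem wreath_generators :
    (∀ x, letter al x = ![1, 0, 3, 2] x ∧ sec al x = 1) ∧
    (∀ x, letter be x = x ∧ sec be x = ![al, ga, al, ga] x) ∧
    (∀ x, letter ga x = x ∧ sec ga x = ![be, 1, 1, be] x) ∧
    (∀ x, letter a x = ![2, 3, 0, 1] x ∧ sec a x = 1) ∧
    (∀ x, letter b x = x ∧ sec b x = ![a * al, a * al, c, c] x) ∧
    (∀ x, letter c x = x ∧ sec c x = ![b * be, b * be, b, b] x) := by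
  refine ⟨fun x => ?_, fun x => ?_, fun x => ?_, fun x => ?_, fun x => ?_, fun x => ?_⟩
  · fin_cases x <;> exact wreath_elt .al _
  · fin_cases x <;> exact wreath_elt .be _
  · fin_cases x <;> exact wreath_elt .ga _
  · fin_cases x <;> exact wreath_elt .a _
  · fin_cases x <;> exact wreath_elt .b _
  · fin_cases x <;> exact wreath_elt .c _

/-! ### The bimodule `𝔐 = X · Γ` -/

/-- The set `X × Γ`; the pair `(x, h)` is `x · h`. -/
def BimodSet : Type := X × Γ

/-- `g · (x · h) = g(x) · g|_x h`. -/
noncomputable instance : MulAction Γ BimodSet where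
  smul g m := (letter g m.1, sec g m.1 * m.2)
  one_smul m := Prod.ext (wreath_one m.1).1
    (show sec 1 m.1 * m.2 = m.2 by rw [(wreath_one m.1).2, one_mul])
  mul_smul g h m := Prod.ext (wreath_mul g h m.1).1
    (show sec (g * h) m.1 * m.2 = sec g (letter h m.1) * (sec h m.1 * m.2) by
      rw [(wreath_mul g h m.1).2, mul_assoc])

/-- `(x · h) · g = x · h g`. -/
instance : MulAction Γᵐᵒᵖ BimodSet where
  smul g m := (m.1, m.2 * unop g)
  one_smul m := Prod.ext rfl (mul_one m.2)
  mul_smul g h m := Prod.ext rfl (mul_assoc m.2 (unop h) (unop g)).symm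

instance : SMulCommClass Γ Γᵐᵒᵖ BimodSet where
  smul_comm g h m := Prod.ext rfl (mul_assoc (sec g m.1) m.2 (unop h)).symm

/-- The bimodule `𝔐`. -/
noncomputable def Bim : Bimodule Γ := ⟨BimodSet⟩

/-- The element `x = x · ε` of `𝔐`. -/
def basisElt (x : X) : BimodSet := (x, 1)

/-- The element `x₁ ⊗ ⋯ ⊗ xₙ` of `𝔐^{⊗ n}`. -/
noncomputable def word : (n : ℕ) → (Fin n → X) → (Bim.pow n).carrier
  | 0, _ => (1 : Γ)
  | n + 1, v => tmul Γ (word n (Fin.init v)) (basisElt (v (Fin.last n)))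

/-! ### The complex `Ξ` -/

/-- The six subgroups `Γ_A, Γ_B, Γ_C, Γ_{A₁}, Γ_{B₁}, Γ_{C₁}`. -/
def sixGroups : Fin 6 → Subgroup Γ :=
  ![Subgroup.closure {be, ga, b, c},
    Subgroup.closure {al, ga, a, c},
    Subgroup.closure {al, be, a, b},
    Subgroup.closure {al, b, c},
    Subgroup.closure {be, a, c * ga},
    Subgroup.closure {ga, a * al, b * be}]

/-- The family `𝒢` of the six subgroups and their pairwise and triple intersections
(the indices may coincide). -/
def groupFamily : Set (Subgroup Γ) :=
  {H | ∃ i j k, H = sixGroups i ⊓ sixGroups j ⊓ sixGroups k}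

/-- The poset, by inclusion, of the subsets `H · g` of `Γ`, for `H ∈ 𝒢` and `g ∈ Γ`. -/
def Coset : Type := {S : Set Γ // ∃ H ∈ groupFamily, ∃ g : Γ, S = (fun h => h * g) '' (H : Set Γ)}

instance : PartialOrder Coset := inferInstanceAs (PartialOrder (Subtype _))

/-- Right translation of cosets. -/
instance : MulAction Γᵐᵒᵖ Coset where
  smul g S := ⟨(fun h => h * unop g) '' S.1, by
    obtain ⟨S, H, hH, k, rfl⟩ := S
    exact ⟨H, hH, k * unop g, by simp only [Set.image_image, mul_assoc]⟩⟩
  one_smul S := Subtype.ext (by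
    change (fun h : Γ => h * unop 1) '' S.1 = S.1
    simp)
  mul_smul g k S := Subtype.ext (by
    change (fun h : Γ => h * unop (g * k)) '' S.1 =
      (fun h : Γ => h * unop g) '' ((fun h : Γ => h * unop k) '' S.1)
    simp only [Set.image_image, unop_mul, mul_assoc])

theorem coset_smul_le (g : Γᵐᵒᵖ) {S T : Coset} (h : S ≤ T) : g • S ≤ g • T :=
  Set.image_mono (f := fun h => h * unop g) (show S.1 ⊆ T.1 from h)

/-- The points of the geometric realization of the order complex of the poset of cosets, in
barycentric coordinates: formal convex combinations of the vertices of a finite chain. -/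
def Xi : Type :=
  {p : Coset →₀ ℝ // (∀ v, 0 ≤ p v) ∧ (p.sum fun _ r => r) = 1 ∧
    IsChain (· ≤ ·) (p.support : Set Coset)}

/-- The closed simplex spanned by a set of vertices. -/
def face (s : Finset Coset) : Set Xi := {p | p.1.support ⊆ s}

/-- The Euclidean topology of a closed simplex, from the barycentric coordinates. -/
@[reducible] def faceTopology (s : Finset Coset) : TopologicalSpace (face s) :=
  TopologicalSpace.induced (fun (p : face s) (v : Coset) => p.1.1 v) inferInstance

/-- The weak topology of the simplicial complex: a set is open if and only if its intersection
with every closed simplex is open in the simplex. -/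
instance : TopologicalSpace Xi :=
  ⨆ s : {s : Finset Coset // IsChain (· ≤ ·) (s : Set Coset)},
    TopologicalSpace.coinduced (Subtype.val : face s.1 → Xi) (faceTopology s.1)

/-- The action of `Γ` on `Ξ` that is affine on simplices and given by right translations on the
vertices. -/
noncomputable instance : MulAction Γᵐᵒᵖ Xi where
  smul g p := ⟨p.1.equivMapDomain (MulAction.toPerm g), by
    obtain ⟨p, h0, h1, h2⟩ := p
    refine ⟨fun v => h0 _, ?_, ?_⟩
    · refine Eq.trans ?_ h1
      rw [Finsupp.equivMapDomain_eq_mapDomain]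
      exact Finsupp.sum_mapDomain_index (fun _ => rfl) (fun _ _ _ => rfl)
    · intro S hS T hT hST
      simp only [Finsupp.mem_support_iff, Finset.mem_coe, Finsupp.equivMapDomain_apply] at hS hT
      have hne : (MulAction.toPerm g).symm S ≠ (MulAction.toPerm g).symm T :=
        fun h => hST ((MulAction.toPerm g).symm.injective h)
      have e : ∀ S : Coset, g • (MulAction.toPerm g).symm S = S :=
        fun S => (MulAction.toPerm g).apply_symm_apply S
      rcases h2 (by simpa using hS) (by simpa using hT) hne with h | h
      · left; simpa only [e] using coset_smul_le g h
      · right; simpa only [e] using coset_smul_le g h⟩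
  one_smul p := Subtype.ext (Finsupp.ext fun v => by
    change p.1 ((MulAction.toPerm (1 : Γᵐᵒᵖ)).symm v) = p.1 v
    congr 1
    rw [Equiv.symm_apply_eq]
    exact (one_smul Γᵐᵒᵖ v).symm)
  mul_smul g k p := Subtype.ext (Finsupp.ext fun v => by
    change p.1 ((MulAction.toPerm (g * k)).symm v) =
      p.1 ((MulAction.toPerm k).symm ((MulAction.toPerm g).symm v))
    congr 1
    rw [Equiv.symm_apply_eq]
    change v = (g * k) • (k⁻¹ • g⁻¹ • v)
    simp [mul_smul])

/-- The subcomplex `𝒯₀` of `Ξ`, the simplicial complex of the poset `𝒢`. -/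
def T0 : Set Xi := {p | ∀ v ∈ p.1.support, ∃ H ∈ groupFamily, v.1 = (H : Set Γ)}

/-! ### The complexes `Ξₙ` and `𝒯ₙ` -/

/-- `Ξₙ = Ξ ⊗ 𝔐^{⊗ n}`. -/
abbrev XiPow (n : ℕ) : Type := Tensor Γ Xi (Bim.pow n).carrier

/-- The subspace `𝒯ₙ = 𝒯₀ ⊗ Xⁿ` of `Ξₙ`. -/
def T (n : ℕ) : Set (XiPow n) := {z | ∃ ξ ∈ T0, ∃ v : Fin n → X, z = tmul Γ ξ (word n v)}

/-- `K_{g,n} = 𝒯ₙ ∩ 𝒯ₙ · g`. -/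
def K (g : Γ) (n : ℕ) : Set (XiPow n) := T n ∩ (fun z => op g • z) '' T n

/-- The map `κ_{g,n} : K_{g,n} → K_{g⁻¹,n}`, `ξ ↦ ξ · g⁻¹`. -/
noncomputable def kappa (g : Γ) (n : ℕ) (z : K g n) : K g⁻¹ n :=
  ⟨op g⁻¹ • z.1, by
    obtain ⟨z, hz, w, hw, rfl⟩ := z
    refine ⟨?_, _, hz, rfl⟩
    change op g⁻¹ • op g • w ∈ T n
    rwa [op_inv, inv_smul_smul]⟩

/-- The map `Ξₙ × 𝔐 → Ξₙ₊₁`, `(ξ ⊗ v, m) ↦ ξ ⊗ v ⊗ m`. -/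
noncomputable def append {n : ℕ} (z : XiPow n) (m : BimodSet) : XiPow (n + 1) :=
  Quotient.map (sb := tensorSetoid Γ Xi (Bim.pow (n + 1)).carrier)
    (fun p => (p.1, (tmul Γ p.2 m : (Bim.pow (n + 1)).carrier)))
    (by
      rintro p q ⟨g, h1, h2⟩
      exact ⟨g, h1, by simp only [h2]; rfl⟩) z

/-- The point `ξ ⊗ x` of `Ξₙ₊₁`, for `ξ ∈ Ξₙ` and a letter `x`. -/
noncomputable def snoc {n : ℕ} (z : XiPow n) (x : X) : XiPow (n + 1) := append z (basisElt x)

/-- The map `𝒯ₙ × X → 𝒯ₙ₊₁`, `(ξ, x) ↦ ξ ⊗ x`. -/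
noncomputable def paste (n : ℕ) (p : T n × X) : T (n + 1) :=
  ⟨snoc p.1.1 p.2, by
    obtain ⟨⟨z, ξ, hξ, v, rfl⟩, x⟩ := p
    refine ⟨ξ, hξ, Fin.snoc v x, ?_⟩
    simp only [word, Fin.init_snoc, Fin.snoc_last]
    rfl⟩

/-- The identifications `(ξ, x) ∼ (κ_{g,n}(ξ), g(x))` on `𝒯ₙ × X`, for `g ∈ 𝔄`, `x ∈ X` and
`ξ ∈ K_{g,n}` such that `g|_x = ε`. -/
def Identified (n : ℕ) (p q : T n × X) : Prop :=
  ∃ g ∈ Aut12, sec g p.2 = 1 ∧ ∃ h : p.1.1 ∈ K g n,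
    q.1.1 = (kappa g n ⟨p.1.1, h⟩).1 ∧ q.2 = letter g p.2

end Pasting

/-!
A simplex of `Ξ` is a chain of cosets with a common element, so `𝒯₀` is a strict fundamental domain
of `Γ`: if `ξ` and `ξ · g⁻¹` both lie in `𝒯₀`, then they are equal, and `g` belongs to the subgroup
at the smallest vertex of the simplex of `ξ` (`exists_stabilizer`). For a point `z` of `𝒯ₙ` put
`S(z) = {g | z · g⁻¹ ∈ 𝒯ₙ}`. Since `z ⊗ x = (z' ⊗ x') · g` means that `z = z' · h`, `h(x) = x'` and
`h|_x = g` for some `h` (`snoc_eq_smul_snoc_iff`), one has `S(z ⊗ x) = {h|_x | h ∈ S(z)}`. All three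
assertions are therefore statements about the sets `S(z)`, and it suffices to know the finitely
many sets that arise from the members of `𝒢` by passing to sections.

* A member of `𝒢` is generated by the states that it contains (`sixGroups_inf`). If such a group
  `G` fixes `z` and `S(z) = G`, then every letter in the `G`-orbit of `x` is reached from `x` by one
  state of `G` with trivial section. So the orbit gives a single point `z ⊗ x`, and `S(z ⊗ x)` is the
  group generated by the sections of the states of `G` at the letters of the orbit
  (`check_child_spec`, `sec_mem`). This group is again a member of `𝒢`, or is generated by one or
  both of the commuting involutions `aαγ`, `αc`.
* In the latter case only the product of the two involutions fails to be a state. It has no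
  trivial section, and each of its sections is also a section of `αc` at the same letter or at a
  letter identified with it (`sec_special_mul`). Hence `S(z ⊗ x) ⊆ 𝔄` from then on, because sections
  of states are states.

This trichotomy is `local_of_mem`. It gives the identifications (`paste_eq_iff`) and the sets
`K_{g,n+1}` (`K_succ`); for the latter one also needs to know which states lie in a group
(`has_of_elt_mem`).

That the intersections of the six groups are generated by states is a finite computation with
portraits truncated at level four. It needs no list of relations of `Γ`: except for the first and
third group, an element of one of the groups that is trivial on three levels is trivial on four,
hence, by passing to sections, on all levels (`small_faithful`); the third group is controlled by
its sections, which lie in the second one. Non-membership in a group is detected by following the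
sections of an element (`compat`).

For the topology, the map that sends the vertex `H · g` to `H` extends to a continuous retraction
`fold` of `Ξ` onto `𝒯₀` that is constant on orbits. A slice of the image in `Ξₙ₊₁` of a closed
subset of `𝒯₀ × Xⁿ × X` is a finite union of intersections of closed subcomplexes with preimages
under `fold` of closed sets, so the parametrization of `𝒯ₙ₊₁` by `𝒯₀ × Xⁿ × X` is a closed map.
It factors through the map `𝒯ₙ × X → 𝒯ₙ₊₁`, which is thus a quotient map (`isQuotientMap_paste`).
-/

namespace Pasting

open MulOpposite

/-! ### Tensor products with the bimodule -/

theorem tmul_eq_iff {G Y M : Type} [Group G] [MulAction Gᵐᵒᵖ Y] [MulAction G M] {y y' : Y}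
    {m m' : M} : tmul G y m = tmul G y' m' ↔ ∃ g : G, y = op g • y' ∧ m' = g • m :=
  Quotient.eq (r := tensorSetoid G Y M)

theorem exists_tmul {n : ℕ} (z : XiPow n) : ∃ ξ u, z = tmul Γ ξ u := by
  obtain ⟨⟨ξ, u⟩, rfl⟩ := Quotient.exists_rep z
  exact ⟨ξ, u, rfl⟩

theorem smul_tmul' {n : ℕ} (g : Γ) (ξ : Xi) (u : (Bim.pow n).carrier) :
    op g • (tmul Γ ξ u : XiPow n) = tmul Γ ξ (op g • u) := rfl

theorem smul_append {n : ℕ} (g : Γ) (z : XiPow n) (m : BimodSet) :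
    op g • append z m = append z (op g • m) := by
  obtain ⟨ξ, u, rfl⟩ := exists_tmul z
  rfl

theorem append_eq_iff {n : ℕ} {z z' : XiPow n} {m m' : BimodSet} :
    append z m = append z' m' ↔ ∃ g : Γ, z = op g • z' ∧ m' = g • m := by
  obtain ⟨ξ, u, rfl⟩ := exists_tmul z
  obtain ⟨ξ', u', rfl⟩ := exists_tmul z'
  refine Iff.trans (tmul_eq_iff (G := Γ) (Y := Xi) (M := (Bim.pow (n + 1)).carrier)) ?_
  constructor
  · rintro ⟨k, rfl, h⟩
    have h : tmul Γ u' m' = tmul Γ (k • u) m := h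
    obtain ⟨g, h1, h2⟩ := tmul_eq_iff.1 h
    refine ⟨g⁻¹, ?_, by rw [h2]; exact (inv_smul_smul g m').symm⟩
    rw [smul_tmul', tmul_eq_iff]
    exact ⟨k, rfl, by rw [h1, op_inv, inv_smul_smul]⟩
  · rintro ⟨g, h, rfl⟩
    rw [smul_tmul', tmul_eq_iff] at h
    obtain ⟨k, rfl, h⟩ := h
    refine ⟨k, rfl, ?_⟩
    change tmul Γ u' (g • m) = tmul Γ (k • u) m
    rw [tmul_eq_iff]
    refine ⟨g⁻¹, ?_, (inv_smul_smul g m).symm⟩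
    rw [← h, op_inv, inv_smul_smul]

theorem smul_basisElt (g : Γ) (x : X) : g • basisElt x = op (sec g x) • basisElt (letter g x) :=
  Prod.ext rfl ((mul_one _).trans (one_mul _).symm)

theorem basisElt_injective_smul {g h : Γ} {x y : X}
    (e : op g • basisElt x = op h • basisElt y) : x = y ∧ g = h := by
  have h1 := congrArg Prod.fst e
  have h2 := congrArg Prod.snd e
  exact ⟨h1, by simpa using (one_mul g).symm.trans (h2.trans (one_mul h))⟩

theorem snoc_smul {n : ℕ} (h : Γ) (z : XiPow n) (x : X) :
    snoc (op h • z) x = op (sec h x) • snoc z (letter h x) := by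
  rw [snoc, snoc, smul_append, append_eq_iff]
  exact ⟨h, rfl, (smul_basisElt h x).symm⟩

theorem snoc_eq_smul_snoc_iff {n : ℕ} {z z' : XiPow n} {x x' : X} {g : Γ} :
    snoc z x = op g • snoc z' x' ↔ ∃ h : Γ, z = op h • z' ∧ letter h x = x' ∧ sec h x = g := by
  rw [snoc, snoc, smul_append, append_eq_iff]
  refine exists_congr fun h => and_congr_right fun _ => ?_
  rw [smul_basisElt]
  constructor
  · intro e
    obtain ⟨h1, h2⟩ := basisElt_injective_smul e
    exact ⟨h1.symm, h2.symm⟩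
  · rintro ⟨rfl, rfl⟩
    rfl

theorem snoc_eq_snoc_iff {n : ℕ} {z z' : XiPow n} {x x' : X} :
    snoc z x = snoc z' x' ↔ ∃ h : Γ, z = op h • z' ∧ letter h x = x' ∧ sec h x = 1 := by
  rw [← snoc_eq_smul_snoc_iff, op_one, one_smul]

theorem snoc_mem {n : ℕ} {z : XiPow n} (hz : z ∈ T n) (x : X) : snoc z x ∈ T (n + 1) :=
  (paste n (⟨z, hz⟩, x)).2

theorem exists_of_mem_T_succ {n : ℕ} {z : XiPow (n + 1)} (hz : z ∈ T (n + 1)) :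
    ∃ w ∈ T n, ∃ x : X, z = snoc w x := by
  obtain ⟨ξ, hξ, v, rfl⟩ := hz
  exact ⟨tmul Γ ξ (word n (Fin.init v)), ⟨ξ, hξ, _, rfl⟩, v (Fin.last n), rfl⟩

theorem mem_K_iff {n : ℕ} {g : Γ} {z : XiPow n} : z ∈ K g n ↔ z ∈ T n ∧ op g⁻¹ • z ∈ T n := by
  refine and_congr_right fun _ => ⟨?_, fun h => ⟨_, h, ?_⟩⟩
  · rintro ⟨w, hw, rfl⟩
    change op g⁻¹ • op g • w ∈ T n
    rwa [op_inv, inv_smul_smul]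
  · change op g • op g⁻¹ • z = z
    rw [op_inv, smul_inv_smul]

theorem exists_of_snoc_mem_K {n : ℕ} {g : Γ} {z : XiPow n} {x : X} (h : snoc z x ∈ K g (n + 1)) :
    ∃ h : Γ, op h⁻¹ • z ∈ T n ∧ sec h x = g := by
  obtain ⟨w, hw, y, e⟩ := exists_of_mem_T_succ (mem_K_iff.1 h).2
  rw [op_inv, inv_smul_eq_iff, snoc_eq_smul_snoc_iff] at e
  obtain ⟨k, rfl, -, e⟩ := e
  exact ⟨k, by rwa [op_inv, inv_smul_smul], e⟩

theorem smul_inv_snoc {n : ℕ} (h : Γ) (z : XiPow n) (x : X) :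
    op (sec h x)⁻¹ • snoc z x = snoc (op h⁻¹ • z) (letter h x) := by
  rw [op_inv, inv_smul_eq_iff, ← snoc_smul, op_inv, smul_inv_smul]

theorem snoc_mem_K {n : ℕ} {h : Γ} {z : XiPow n} (hz : z ∈ K h n) (x : X) :
    snoc z x ∈ K (sec h x) (n + 1) := by
  rw [mem_K_iff] at hz ⊢
  exact ⟨snoc_mem hz.1 x, smul_inv_snoc h z x ▸ snoc_mem hz.2 _⟩

/-! ### Vertices of the complex and their stabilizers -/

/-- The vertices of the fundamental domain. -/
def IsBase (v : Coset) : Prop := ∃ H ∈ groupFamily, v.1 = (H : Set Γ)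

theorem coset_smul_val (g : Γ) (v : Coset) : (op g • v).1 = (fun h => h * g) '' v.1 := rfl

/-- An inclusion of cosets `H · g ⊆ H' · g'` determines an inclusion of the subgroups. -/
theorem le_of_coset_subset {H H' : Subgroup Γ} {g g' : Γ}
    (h : (fun x => x * g) '' (H : Set Γ) ⊆ (fun x => x * g') '' (H' : Set Γ)) :
    H ≤ H' ∧ g * g'⁻¹ ∈ H' := by
  obtain ⟨k, hk, e⟩ := h ⟨1, H.one_mem, one_mul g⟩
  have hg : g * g'⁻¹ ∈ H' := by
    have e : k * g' = g := e
    rw [← e, mul_inv_cancel_right]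
    exact hk
  refine ⟨fun x hx => ?_, hg⟩
  obtain ⟨y, hy, e⟩ := h ⟨x, hx, rfl⟩
  have e : y * g' = x * g := e
  have : x = y * (g * g'⁻¹)⁻¹ := by rw [mul_inv_rev, inv_inv, ← mul_assoc, e, mul_inv_cancel_right]
  rw [this]
  exact H'.mul_mem hy (H'.inv_mem hg)

theorem coset_smul_eq_self {v : Coset} {H : Subgroup Γ} (hv : v.1 = (H : Set Γ)) {g : Γ}
    (hg : g ∈ H) : op g • v = v := by
  refine Subtype.ext ?_
  rw [coset_smul_val, hv]
  ext x
  constructor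
  · rintro ⟨y, hy, rfl⟩
    exact H.mul_mem hy hg
  · exact fun hx => ⟨x * g⁻¹, H.mul_mem hx (H.inv_mem hg), inv_mul_cancel_right x g⟩

/-- The vertex of the fundamental domain in the orbit of a vertex. -/
noncomputable def base (v : Coset) : Coset :=
  ⟨(v.2.choose : Set Γ), v.2.choose, v.2.choose_spec.1, 1, by simp⟩

theorem base_mono {v w : Coset} (h : v ≤ w) : base v ≤ base w := by
  obtain ⟨g, hg⟩ := v.2.choose_spec.2
  obtain ⟨k, hk⟩ := w.2.choose_spec.2
  have h : v.1 ⊆ w.1 := h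
  rw [hg, hk] at h
  exact (le_of_coset_subset h).1

theorem base_smul (g : Γ) (v : Coset) : base (op g • v) = base v := by
  obtain ⟨k, hk⟩ := v.2.choose_spec.2
  obtain ⟨l, hl⟩ := (op g • v).2.choose_spec.2
  have e : (fun x => x * l) '' ((op g • v).2.choose : Set Γ) =
      (fun x => x * (k * g)) '' (v.2.choose : Set Γ) := by
    rw [← hl, coset_smul_val]
    conv_lhs => rw [hk]
    rw [Set.image_image]
    simp only [mul_assoc]
  exact le_antisymm (le_of_coset_subset e.subset).1 (le_of_coset_subset e.symm.subset).1

theorem base_eq_self {v : Coset} (h : IsBase v) : base v = v := by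
  obtain ⟨H, hH, hv⟩ := h
  obtain ⟨g, hg⟩ := v.2.choose_spec.2
  have e : (fun x => x * g) '' (v.2.choose : Set Γ) = (fun x => x * 1) '' (H : Set Γ) := by
    rw [← hg, hv]; simp
  have := le_antisymm (le_of_coset_subset e.subset).1 (le_of_coset_subset e.symm.subset).1
  exact Subtype.ext ((congrArg _ this).trans hv.symm)

theorem xi_smul_apply (g : Γ) (p : Xi) (v : Coset) : (op g • p).1 v = p.1 (op g⁻¹ • v) := rfl

/-- The subgroup at the smallest vertex of the simplex that contains a point of the fundamental
domain is the stabilizer of the point, and no other element moves the point to a point of the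
fundamental domain. -/
theorem exists_stabilizer {p : Xi} (hp : p ∈ T0) : ∃ H ∈ groupFamily,
    (∀ h ∈ H, op h • p = p) ∧ ∀ g : Γ, op g⁻¹ • p ∈ T0 → g ∈ H := by
  have hne : p.1.support.Nonempty := by
    rw [Finset.nonempty_iff_ne_empty]
    intro h
    have := p.2.2.1
    rw [Finsupp.sum, h, Finset.sum_empty] at this
    exact zero_ne_one this
  obtain ⟨m, hm⟩ := Finset.exists_minimal hne
  have hle : ∀ v ∈ p.1.support, m ≤ v := fun v hv =>
    (p.2.2.2.total hm.1 hv).elim id fun h => hm.2 hv h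
  obtain ⟨H, hH, hmH⟩ := hp m hm.1
  refine ⟨H, hH, fun h hh => ?_, fun g hg => ?_⟩
  · have fix : ∀ v ∈ p.1.support, ∀ k ∈ H, op k • v = v := by
      intro v hv k hk
      obtain ⟨H', -, hv'⟩ := hp v hv
      refine coset_smul_eq_self hv' ?_
      have hle : m.1 ⊆ v.1 := hle v hv
      rw [hmH, hv'] at hle
      exact hle hk
    refine Subtype.ext (Finsupp.ext fun v => ?_)
    rw [xi_smul_apply]
    by_cases hv : v ∈ p.1.support
    · rw [fix v hv _ (H.inv_mem hh)]
    · by_cases hv' : op h⁻¹ • v ∈ p.1.support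
      · have := fix _ hv' h hh
        rw [op_inv, smul_inv_smul] at this
        rw [op_inv, ← this]
      · rw [Finsupp.notMem_support_iff.1 hv, Finsupp.notMem_support_iff.1 hv']
  · have hs : op g⁻¹ • m ∈ (op g⁻¹ • p).1.support := by
      rw [Finsupp.mem_support_iff, xi_smul_apply, inv_inv, op_inv, smul_inv_smul]
      exact Finsupp.mem_support_iff.1 hm.1
    obtain ⟨H', -, h'⟩ := hg _ hs
    have e : (fun x => x * g⁻¹) '' (H : Set Γ) = (fun x => x * 1) '' (H' : Set Γ) := by
      rw [← hmH, ← coset_smul_val, h']; simp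
    have := (le_of_coset_subset e.symm.subset).2
    simpa using this

/-! ### The topology of the complex -/

theorem isClosed_xi_iff {C : Set Xi} : IsClosed C ↔
    ∀ s : Finset Coset, IsChain (· ≤ ·) (s : Set Coset) →
      @IsClosed _ (faceTopology s) ((Subtype.val : face s → Xi) ⁻¹' C) := by
  rw [isClosed_iSup_iff]
  simp only [isClosed_coinduced, Subtype.forall]

open Classical in
/-- A union of closed simplices is closed. -/
theorem isClosed_of_support {P : Finset Coset → Prop} (hP : ∀ s t, s ⊆ t → P t → P s) :
    IsClosed {p : Xi | P p.1.support} := by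
  rw [isClosed_xi_iff]
  intro s _
  let _ := faceTopology s
  have hc : ∀ v : Coset, Continuous fun p : face s => p.1.1 v := fun v =>
    (continuous_apply v).comp continuous_induced_dom
  have e : (Subtype.val : face s → Xi) ⁻¹' {p : Xi | P p.1.support} =
      ⋃ t ∈ {t ∈ s.powerset | P t}, {p : face s | ∀ v, v ∉ t → p.1.1 v = 0} := by
    ext p
    simp only [Set.mem_preimage, Set.mem_ofPred_eq, Set.mem_iUnion, Finset.mem_filter, exists_prop]
    constructor
    · intro h
      exact ⟨p.1.1.support, ⟨Finset.mem_powerset.2 (fun v hv => p.2 hv), h⟩,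
        fun v hv => Finsupp.notMem_support_iff.1 hv⟩
    · rintro ⟨t, ⟨-, ht⟩, h⟩
      refine hP _ _ (fun v hv => ?_) ht
      by_contra hv'
      exact Finsupp.mem_support_iff.1 hv (h v hv')
  rw [e]
  refine Set.Finite.isClosed_biUnion (Finset.finite_toSet _) fun t _ => ?_
  simp only [Set.ofPred_forall]
  exact isClosed_iInter fun v => isClosed_iInter fun _ => isClosed_eq (hc v) continuous_const

/-- A union of translates of the fundamental domain is a subcomplex, hence closed. -/
theorem isClosed_translates (Q : Set Γ) : IsClosed {p : Xi | ∃ g ∈ Q, op g⁻¹ • p ∈ T0} := by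
  have := isClosed_of_support (P := fun t => ∃ g ∈ Q, ∀ v ∈ t, IsBase (op g⁻¹ • v))
    fun s t h ⟨g, hg, ht⟩ => ⟨g, hg, fun v hv => ht v (h hv)⟩
  convert this using 1
  ext p
  refine exists_congr fun g => and_congr_right fun _ => ⟨fun h v hv => ?_, fun h v hv => ?_⟩
  · refine h _ ?_
    rw [Finsupp.mem_support_iff, xi_smul_apply, inv_inv, op_inv, smul_inv_smul]
    exact Finsupp.mem_support_iff.1 hv
  · rw [Finsupp.mem_support_iff, xi_smul_apply, inv_inv] at hv
    have := h _ (Finsupp.mem_support_iff.2 hv)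
    rwa [op_inv, inv_smul_smul] at this

theorem isClosed_T0 : IsClosed T0 :=
  isClosed_of_support (P := fun t => ∀ v ∈ t, IsBase v) fun _ _ h ht v hv => ht v (h hv)

open Classical in
/-- The retraction of the complex onto the fundamental domain along the orbits of the group. -/
noncomputable def fold (p : Xi) : Xi :=
  ⟨p.1.mapDomain base, by
    refine ⟨fun v => ?_, ?_, ?_⟩
    · rw [Finsupp.mapDomain, Finsupp.sum_apply]
      exact Finset.sum_nonneg fun u _ => Finsupp.single_nonneg.2 (p.2.1 u) v
    · refine (Finsupp.sum_mapDomain_index (fun _ => rfl) fun _ _ _ => rfl).trans p.2.2.1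
    · refine IsChain.mono (t := (p.1.support.image base : Finset Coset))
        (fun v hv => Finsupp.mapDomain_support hv) ?_
      rw [Finset.coe_image]
      exact p.2.2.2.image_of_map_rel _ _ _ fun _ _ h => base_mono h⟩

theorem fold_eq_self {p : Xi} (hp : p ∈ T0) : fold p = p :=
  Subtype.ext ((Finsupp.mapDomain_congr fun v hv => base_eq_self (hp v hv)).trans
    Finsupp.mapDomain_id)

theorem fold_smul (g : Γ) (p : Xi) : fold (op g • p) = fold p := by
  refine Subtype.ext ?_
  change Finsupp.mapDomain base (p.1.equivMapDomain (MulAction.toPerm (op g))) = _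
  rw [Finsupp.equivMapDomain_eq_mapDomain, ← Finsupp.mapDomain_comp]
  exact Finsupp.mapDomain_congr fun v _ => base_smul g v

open Classical in
theorem continuous_fold : Continuous fold := by
  refine continuous_iSup_dom.2 fun s => continuous_coinduced_dom.2 ?_
  obtain ⟨s, hs⟩ := s
  let _ := faceTopology s
  let s' : Finset Coset := s.image base
  let _ := faceTopology s'
  have hs' : IsChain (· ≤ ·) (s' : Set Coset) := by
    rw [Finset.coe_image]
    exact hs.image_of_map_rel _ _ _ fun _ _ h => base_mono h
  have hmem : ∀ p : face s, fold p.1 ∈ face s' := fun p =>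
    Finsupp.mapDomain_support.trans (Finset.image_subset_image p.2)
  have h1 : Continuous (Subtype.val : face s' → Xi) :=
    continuous_iff_coinduced_le.2 (le_iSup
      (fun s : {s : Finset Coset // IsChain (· ≤ ·) (s : Set Coset)} =>
        TopologicalSpace.coinduced (Subtype.val : face s.1 → Xi) (faceTopology s.1)) ⟨s', hs'⟩)
  have h2 : Continuous fun p : face s => (⟨fold p.1, hmem p⟩ : face s') := by
    refine continuous_induced_rng.2 (continuous_pi fun v => ?_)
    have e : ∀ p : face s, (fold p.1).1 v = ∑ u ∈ s, if base u = v then p.1.1 u else 0 := by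
      intro p
      change Finsupp.mapDomain base p.1.1 v = _
      rw [Finsupp.mapDomain, Finsupp.sum_apply, Finsupp.sum_of_support_subset _ p.2 _ (by simp)]
      simp only [Finsupp.single_apply]
    change Continuous fun p : face s => (fold p.1).1 v
    simp only [e]
    refine continuous_finsetSum _ fun u _ => ?_
    split_ifs
    · exact (continuous_apply u).comp continuous_induced_dom
    · exact continuous_const
  exact h1.comp h2

/-- In a product with a discrete space a set is closed if its slices are. -/
theorem isClosed_of_slices {Y M : Type} [TopologicalSpace Y] [TopologicalSpace M]
    [DiscreteTopology M] {C : Set (Y × M)} (h : ∀ m, IsClosed {y | (y, m) ∈ C}) : IsClosed C := by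
  have e : Cᶜ = ⋃ m, {y | (y, m) ∈ C}ᶜ ×ˢ {m} := by
    ext ⟨y, m⟩
    simp
  rw [← isOpen_compl_iff, e]
  exact isOpen_iUnion fun m => (h m).isOpen_compl.prod (isOpen_discrete _)

/-- The image of a closed subset of finitely many copies of `𝒯₀` is closed. The points `ξ` such that
`ξ ⊗ m` lies in the image of a closed subset of one copy form the part inside a subcomplex of its
preimage under `fold`. This replaces an infinite union of translates by a single closed set. -/
theorem isClosed_image_tmul {n : ℕ} {I : Type} [Finite I] [TopologicalSpace I]
    [DiscreteTopology I] (f : I → (Bim.pow n).carrier) {C : Set (T0 × I)} (hC : IsClosed C) :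
    IsClosed ((fun p : T0 × I => (tmul Γ p.1.1 (f p.2) : XiPow n)) '' C) := by
  let _ : TopologicalSpace (Bim.pow n).carrier := ⊥
  have : DiscreteTopology (Bim.pow n).carrier := ⟨rfl⟩
  refine isClosed_coinduced.2 (isClosed_of_slices fun m => ?_)
  let D : I → Set Xi := fun i => Subtype.val '' {η : T0 | (η, i) ∈ C}
  have hD : ∀ i, IsClosed (D i) := fun i =>
    isClosed_T0.isClosedEmbedding_subtypeVal.isClosedMap _
      (hC.preimage (Continuous.prodMk continuous_id continuous_const))
  have e : {ξ | (ξ, m) ∈ (fun p : Xi × (Bim.pow n).carrier => (tmul Γ p.1 p.2 : XiPow n)) ⁻¹'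
      ((fun p : T0 × I => (tmul Γ p.1.1 (f p.2) : XiPow n)) '' C)} =
      ⋃ i, fold ⁻¹' D i ∩ {ξ | ∃ g ∈ {g : Γ | f i = g • m}, op g⁻¹ • ξ ∈ T0} := by
    ext ξ
    simp only [Set.mem_ofPred_eq, Set.mem_preimage, Set.mem_image, Set.mem_iUnion, Set.mem_inter_iff]
    constructor
    · rintro ⟨⟨η, i⟩, h, e⟩
      obtain ⟨g, rfl, h2⟩ := tmul_eq_iff.1 e.symm
      refine ⟨i, ⟨η, h, ?_⟩, g, h2, ?_⟩
      · rw [fold_smul, fold_eq_self η.2]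
      · rw [op_inv, inv_smul_smul]
        exact η.2
    · rintro ⟨i, ⟨η, h, e⟩, g, h2, h3⟩
      refine ⟨(η, i), h, (tmul_eq_iff.2 ⟨g, ?_, h2⟩).symm⟩
      have : op g⁻¹ • ξ = η := by rw [← fold_eq_self h3, fold_smul, e]
      rw [← this, op_inv, smul_inv_smul]
  rw [e]
  exact isClosed_iUnion_of_finite fun i =>
    ((hD i).preimage continuous_fold).inter (isClosed_translates _)

theorem continuous_tmul {n : ℕ} (m : (Bim.pow n).carrier) :
    Continuous fun ξ : Xi => (tmul Γ ξ m : XiPow n) := by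
  let _ : TopologicalSpace (Bim.pow n).carrier := ⊥
  have h : Continuous fun p : Xi × (Bim.pow n).carrier => (tmul Γ p.1 p.2 : XiPow n) :=
    continuous_coinduced_rng
  exact h.comp (Continuous.prodMk continuous_id continuous_const)

theorem continuous_snoc {n : ℕ} (x : X) : Continuous fun z : XiPow n => snoc z x := by
  let _ : TopologicalSpace (Bim.pow n).carrier := ⊥
  have : DiscreteTopology (Bim.pow n).carrier := ⟨rfl⟩
  refine continuous_coinduced_dom.2 ?_
  refine continuous_prod_of_discrete_right.2 fun u => ?_
  exact continuous_tmul (n := n + 1) (tmul Γ u (basisElt x) : (Bim.pow (n + 1)).carrier)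

theorem continuous_paste (n : ℕ) : Continuous (paste n) := by
  refine continuous_induced_rng.2 (continuous_prod_of_discrete_right.2 fun x => ?_)
  exact (continuous_snoc x).comp continuous_subtype_val

/-- The parametrization of `𝒯ₙ × X` by `𝒯₀ × Xⁿ × X`. -/
noncomputable def param (n : ℕ) (p : T0 × ((Fin n → X) × X)) : T n × X :=
  (⟨tmul Γ p.1.1 (word n p.2.1), p.1.1, p.1.2, p.2.1, rfl⟩, p.2.2)

theorem isQuotientMap_paste (n : ℕ) : Topology.IsQuotientMap (paste n) := by
  have hc : Continuous (param n) := by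
    refine continuous_prod_of_discrete_right.2 fun i =>
      Continuous.prodMk ?_ (continuous_const (y := i.2))
    exact continuous_induced_rng.2 ((continuous_tmul (word n i.1)).comp continuous_subtype_val)
  refine Topology.IsQuotientMap.of_comp hc (continuous_paste n) ?_
  refine IsClosedMap.isQuotientMap ?_ ((continuous_paste n).comp hc) ?_
  · intro C hC
    have h := isClosed_image_tmul (n := n + 1)
      (fun i : (Fin n → X) × X => (tmul Γ (word n i.1) (basisElt i.2) :
        (Bim.pow (n + 1)).carrier)) hC
    convert h.preimage (continuous_subtype_val (p := (· ∈ T (n + 1)))) using 1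
    ext z
    simp only [Set.mem_image, Set.mem_preimage]
    exact exists_congr fun p => and_congr_right fun _ => Subtype.ext_iff
  · rintro ⟨z, hz⟩
    obtain ⟨ξ, hξ, v, rfl⟩ := hz
    exact ⟨(⟨ξ, hξ⟩, Fin.init v, v (Fin.last n)), rfl⟩

/-! ### Portraits -/

/-- A finite truncation of the portrait of an automorphism of the tree of words: at each vertex
the number `v` such that the local permutation is `x ↦ v xor x`. -/
inductive Tree
  | leaf
  | node (v : ℕ) (t₀ t₁ t₂ t₃ : Tree)

namespace Tree

/-- The portrait of a product. At the letter `x` the section of `gh` is `g|_{h(x)} h|_x`. Like the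
other functions on trees it is given by the recursor, which the kernel evaluates quickly. -/
noncomputable def mul (s : Tree) : Tree → Tree :=
  Tree.rec (motive := fun _ => Tree → Tree) (fun _ => leaf)
    (fun v _ _ _ _ f₀ f₁ f₂ f₃ t => Tree.casesOn t leaf fun w b₀ b₁ b₂ b₃ =>
      Nat.casesOn w (node v (f₀ b₀) (f₁ b₁) (f₂ b₂) (f₃ b₃)) fun w' =>
      Nat.casesOn w' (node (v ^^^ w) (f₁ b₀) (f₀ b₁) (f₃ b₂) (f₂ b₃)) fun w'' =>
      Nat.casesOn w'' (node (v ^^^ w) (f₂ b₀) (f₃ b₁) (f₀ b₂) (f₁ b₃)) fun _ =>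
      node (v ^^^ w) (f₃ b₀) (f₂ b₁) (f₁ b₂) (f₀ b₃)) s

/-- Equality of portraits as a Boolean. -/
noncomputable def beq (s : Tree) : Tree → Bool :=
  Tree.rec (motive := fun _ => Tree → Bool)
    (fun t => Tree.casesOn t true fun _ _ _ _ _ => false)
    (fun v _ _ _ _ f₀ f₁ f₂ f₃ t => Tree.casesOn t false fun w b₀ b₁ b₂ b₃ =>
      v.beq w && (f₀ b₀ && (f₁ b₁ && (f₂ b₂ && f₃ b₃)))) s

/-- Membership of a truncated portrait in a list. -/
noncomputable def mem (t : Tree) (l : List Tree) : Bool :=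
  l.any (beq t)

/-- `orbit gens fuel todo acc` closes the list `acc` under left multiplication by `gens`, as far as
the fuel allows; `todo` lists the elements of `acc` that remain to be multiplied. -/
noncomputable def orbit (gens : List Tree) : ℕ → List Tree → List Tree → List Tree
  | 0, _, acc => acc
  | _, [], acc => acc
  | n + 1, t :: todo, acc =>
    let new := gens.foldr (fun s l => bif mem (mul s t) (l ++ acc) then l else mul s t :: l) []
    orbit gens n (todo ++ new) (new ++ acc)

end Tree

namespace St

/-- The number `v` such that the permutation at a state is `x ↦ v xor x`. -/
def lab : St → ℕ
  | al | alc => 1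
  | a => 2
  | aal | aalga => 3
  | _ => 0

/-- The sections of a state, in a form that evaluates quickly. -/
def step : St → ℕ → St
  | be, 0 => al | be, 1 => ga | be, 2 => al | be, _ => ga
  | ga, 0 => be | ga, 1 => one | ga, 2 => one | ga, _ => be
  | aalga, 0 => be | aalga, 1 => one | aalga, 2 => one | aalga, _ => be
  | b, 0 => aal | b, 1 => aal | b, 2 => c | b, _ => c
  | c, 0 => bbe | c, 1 => bbe | c, 2 => b | c, _ => b
  | alc, 0 => bbe | alc, 1 => bbe | alc, 2 => b | alc, _ => b
  | bbe, 0 => a | bbe, 1 => aalga | bbe, 2 => alc | bbe, _ => cga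
  | cga, 0 => b | cga, 1 => bbe | cga, 2 => b | cga, _ => bbe
  | _, _ => one

/-- The truncated portrait of a state. -/
def tree : ℕ → St → Tree
  | 0, _ => .leaf
  | n + 1, q =>
    .node q.lab (tree n (q.step 0)) (tree n (q.step 1)) (tree n (q.step 2)) (tree n (q.step 3))

/-- The position of a state in the binary code of a set of states. -/
def code : St → ℕ
  | one => 0 | al => 1 | be => 2 | ga => 3 | a => 4 | b => 5 | c => 6
  | aal => 7 | bbe => 8 | cga => 9 | aalga => 10 | alc => 11

/-- The list of all states. -/
def all : List St := [one, al, be, ga, a, b, c, aal, bbe, cga, aalga, alc]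

end St

/-! ### Sets of states -/

/-- Membership of a state in the set of states with binary code `m`. -/
def has (m : ℕ) (q : St) : Bool := m.testBit q.code

/-- The binary code of a list of states. -/
def mask (l : List St) : ℕ := l.foldr (fun q m => m ||| 2 ^ q.code) 0

open St in
/-- The codes of the sets of the states that lie in the six groups. -/
def stab : Fin 6 → ℕ :=
  ![mask [one, be, ga, b, c, bbe, cga], mask [one, al, ga, a, c, aal, cga, aalga, alc],
    mask [one, al, be, a, b, aal, bbe], mask [one, al, b, c, alc], mask [one, be, a, cga],
    mask [one, ga, aal, bbe, aalga]]

/-- The codes of the intersections of at most three of the six sets of states. -/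
def family : List ℕ :=
  ((List.finRange 6).flatMap fun i => (List.finRange 6).flatMap fun j =>
    (List.finRange 6).map fun k => stab i &&& stab j &&& stab k).dedup

open St in
/-- The codes of the sets of states that generate groups of sections outside the family. -/
def special : List ℕ := [mask [one, aalga], mask [one, alc], mask [one, aalga, alc]]

/-- `x` and `y` are related if a state of `m` takes `x` to `y` with trivial section. -/
def linked (m x y : ℕ) : Bool :=
  St.all.any fun s => has m s && (s.lab ^^^ x).beq y && (s.step x).code.beq 0

/-- The code of the set of the sections of the states of `m` at the letters linked to `x`. -/
def child (m x : ℕ) : ℕ :=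
  [0, 1, 2, 3].foldr (fun y r => bif linked m x y then
    St.all.foldr (fun s r => bif has m s then r ||| 2 ^ (s.step y).code else r) r else r) 0


/-- `f n`, with `n` evaluated first, and `false` for `n = 0`. -/
def pass (n : ℕ) (f : ℕ → Bool) : Bool := Nat.casesOn n false fun r => f (r + 1)

/-- Triviality of a truncated portrait on the first `n` levels. -/
noncomputable def triv (n : ℕ) (t : Tree) : Bool :=
  Tree.rec (motive := fun _ => ℕ → Bool) (fun _ => true)
    (fun v _ _ _ _ f₀ f₁ f₂ f₃ n => Nat.casesOn n true fun n =>
      v.beq 0 && (f₀ n && (f₁ n && (f₂ n && f₃ n)))) t n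

/-- A necessary condition on the truncated portrait of an element of the group generated by the
states of `m`: the root label is that of a state of `m`, and the branches satisfy the condition
for the groups that contain the sections. An element of a special group is trivial if its root
label is `0`. -/
noncomputable def compat (m : ℕ) (t : Tree) : Bool :=
  Tree.rec (motive := fun _ => ℕ → Bool) (fun _ => true)
    (fun v t₀ t₁ t₂ t₃ f₀ f₁ f₂ f₃ m =>
      bif special.any m.beq then !v.beq 0 || triv 4 (.node v t₀ t₁ t₂ t₃) else
        (St.all.any fun s => has m s && s.lab.beq v) && (pass (child m 0) f₀ &&
          (pass (child m 1) f₁ && (pass (child m 2) f₂ && pass (child m 3) f₃)))) t m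

/-! ### Finite computations with portraits -/

section Checks

open St

/-- The list of the portraits, truncated at level four, of the elements of the group that is
generated by a list of states. -/
noncomputable def image (l : List St) : List Tree :=
  Tree.orbit (l.map (tree 4)) 100 [tree 4 one] [tree 4 one]

/-- The portraits of the elements of the group generated by the states of `m`. -/
noncomputable def imageOf (m : ℕ) : List Tree := image (all.filter (has m))

/-- Codes of sets of states, each with states that generate the same group. The groups are the
second, fourth, fifth and sixth of the six groups and `⟨β, b⟩`; up to inclusion they contain all
groups of sections of their elements that are not special. -/
def small : List (ℕ × List St) :=
  [(stab 1, [al, ga, a, c]), (stab 3, [al, b, c]), (stab 4, [be, a, cga]),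
    (stab 5, [ga, aal, bbe]), (mask [one, be, b, bbe], [be, b])]

/-- Generators of the first of the six groups. -/
def large : List St := [be, ga, b, c]

set_option maxRecDepth 100000

/-- For each group of the list `small`: the list of portraits is closed under multiplication by the
generators, triviality on three levels implies triviality on four levels, and the portraits that
are compatible with two of the six groups are those of products of the common states. -/
theorem check_small : (small.all fun p =>
    (p.2.all fun s => (image p.2).all fun t =>
      Tree.mem (Tree.mul (tree 4 s) t) (image p.2)) &&
    ((image p.2).all fun t => !triv 3 t || triv 4 t) &&
    (List.finRange 6).all fun j => (List.finRange 6).all fun k =>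
      (p.1 &&& stab j &&& stab k).beq p.1 ||
        pass (p.1 &&& stab j &&& stab k) fun m => (image p.2).all fun t =>
          !compat (stab j) t || (!compat (stab k) t || Tree.mem t (imageOf m))) = true := by
  decide +kernel

/-- For the first of the six groups: the list of portraits is closed under multiplication by the
generators, and those compatible with the third group are portraits of products of the common
states. -/
theorem check_large :
    ((large.all fun s => (image large).all fun t =>
      Tree.mem (Tree.mul (tree 4 s) t) (image large)) &&
    (image large).all fun t =>
      !compat (stab 2) t || Tree.mem t (imageOf (stab 0 &&& stab 2))) = true := by
  decide +kernel

/-- A state whose portrait is compatible with a group of the family belongs to the group. -/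
theorem check_has : (family.all fun m => all.all fun s =>
    !compat m (tree 4 s) || has m s) = true := by decide +kernel

/-- The sections of a group of the family: the letters linked to `x` form an orbit, and the states
in the group of sections at `x` are exactly the sections of states at the letters of the orbit. -/
theorem check_child : (family.all fun m => [0, 1, 2, 3].all fun x =>
    ((family ++ special).any fun m' => m'.beq (child m x)) && linked m x x &&
    ([0, 1, 2, 3].all fun y => !linked m x y || all.all fun s => !has m s ||
      linked m x (s.lab ^^^ y) && has (child m x) (s.step y)) &&
    (all.all fun q => !has (child m x) q || [0, 1, 2, 3].any fun y => linked m x y &&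
      all.any fun s => has m s && (s.step y).code.beq q.code)) = true := by decide +kernel

/-- The states are distinguished from `ε`, `aαγ`, `αc` and from the product of the last two by the
portraits of quotients; states are involutions, so products serve as quotients. -/
theorem check_special : (all.all fun q =>
    ([one, aalga, alc].all fun s =>
      !triv 4 (Tree.mul (tree 4 q) (tree 4 s)) || q.code.beq s.code) &&
    !triv 4 (Tree.mul (tree 4 q) (Tree.mul (tree 4 aalga) (tree 4 alc)))) = true := by
  decide +kernel

/-- The letter permutations at the states of a group of the family are closed under products. -/
theorem check_lab : (family.all fun m => has m one && all.all fun s => all.all fun t =>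
    !has m s || (!has m t || all.any fun u => has m u && u.lab.beq (s.lab ^^^ t.lab))) = true := by
  decide +kernel

/-- The groups of sections of the groups in `small` are special or contained in such groups. -/
theorem check_small_child : (small.all fun p => [0, 1, 2, 3].all fun x =>
    (special.any fun m => m.beq (child p.1 x)) ||
      small.any fun p' => (child p.1 x &&& p'.1).beq (child p.1 x)) = true := by decide +kernel

end Checks

/-! ### The groups generated by sets of states -/

theorem St.next_eq_step (q : St) (x : X) : q.next x = q.step x.val := by
  cases q <;> fin_cases x <;> rfl

theorem St.out_eq_xor (q : St) (x : X) : (q.out x).val = q.lab ^^^ x.val := by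
  cases q <;> revert x <;> decide

theorem St.mem_all (q : St) : q ∈ St.all := by cases q <;> simp [St.all]

theorem St.code_injective : Function.Injective St.code := by
  intro q r h
  cases q <;> cases r <;> first | rfl | exact absurd h (by decide)

theorem St.elt_mul_self (q : St) : q.elt * q.elt = 1 :=
  Subtype.ext (Equiv.ext fun v => by
    change (q.elt : Equiv.Perm (List X)) ((q.elt : Equiv.Perm (List X)) v) = v
    rw [St.elt_apply, St.elt_apply, St.run_involutive])

theorem St.elt_inv (q : St) : q.elt⁻¹ = q.elt := inv_eq_of_mul_eq_one_right q.elt_mul_self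

theorem St.elt_mem (q : St) : q.elt ∈ Aut12 := by
  cases q <;> simp [Aut12, St.elt]

theorem exists_elt_of_mem {g : Γ} (h : g ∈ Aut12) : ∃ q : St, q.elt = g := by
  simp only [Aut12, Set.mem_insert_iff, Set.mem_singleton_iff] at h
  rcases h with rfl | rfl | rfl | rfl | rfl | rfl | rfl | rfl | rfl | rfl | rfl | rfl
  exacts [⟨.al, rfl⟩, ⟨.be, rfl⟩, ⟨.ga, rfl⟩, ⟨.a, rfl⟩, ⟨.b, rfl⟩, ⟨.c, rfl⟩, ⟨.aal, rfl⟩,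
    ⟨.bbe, rfl⟩, ⟨.cga, rfl⟩, ⟨.aalga, rfl⟩, ⟨.alc, rfl⟩, ⟨.one, rfl⟩]

/-- The subgroup generated by a set of states. -/
def spanned (s : Set St) : Subgroup Γ := Subgroup.closure (St.elt '' s)

theorem elt_mem_spanned {s : Set St} {q : St} (h : q ∈ s) : q.elt ∈ spanned s :=
  Subgroup.subset_closure ⟨q, h, rfl⟩

theorem spanned_mono {s t : Set St} (h : s ⊆ t) : spanned s ≤ spanned t :=
  Subgroup.closure_mono (Set.image_mono h)

theorem spanned_le {s : Set St} {H : Subgroup Γ} (h : ∀ q ∈ s, q.elt ∈ H) : spanned s ≤ H :=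
  (Subgroup.closure_le H).2 (by rintro _ ⟨q, hq, rfl⟩; exact h q hq)

/-- Induction by left multiplication; states are involutions, so inverses are not needed. -/
theorem spanned_induction {s : Set St} {p : Γ → Prop} (one : p 1)
    (mul : ∀ q ∈ s, ∀ g ∈ spanned s, p g → p (q.elt * g)) {g : Γ} (hg : g ∈ spanned s) : p g := by
  induction hg using Subgroup.closure_induction_left with
  | one => exact one
  | mul_left x hx y hy h => obtain ⟨q, hq, rfl⟩ := hx; exact mul q hq y hy h
  | inv_mul_cancel x hx y hy h =>
    obtain ⟨q, hq, rfl⟩ := hx; rw [St.elt_inv]; exact mul q hq y hy h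

theorem spanned_univ : spanned Set.univ = ⊤ := by
  have h := Subgroup.closure_closure_coe_preimage
    (k := ({St.al.perm, St.be.perm, St.ga.perm, St.a.perm, St.b.perm, St.c.perm} :
      Set (Equiv.Perm (List X))))
  rw [eq_top_iff]
  refine (top_le_iff.2 h).trans ((Subgroup.closure_le _).2 ?_)
  intro g hg
  have key : ∀ q : St, q.perm = g.1 → g ∈ spanned Set.univ := fun q hq => by
    have : q.elt = g := Subtype.ext (Equiv.ext fun v => by rw [St.elt_apply, ← hq]; rfl)
    exact this ▸ elt_mem_spanned (Set.mem_univ q)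
  simp only [Set.mem_preimage, Set.mem_insert_iff, Set.mem_singleton_iff] at hg
  rcases hg with h | h | h | h | h | h <;> exact key _ h.symm

/-! ### Portraits of elements -/

/-- The elements of `Γ` permute the letters by `x ↦ v xor x`. -/
theorem letter_val (g : Γ) (x : X) :
    (letter g x).val = (letter g 0).val ^^^ x.val := by
  have hg : g ∈ spanned Set.univ := spanned_univ ▸ Subgroup.mem_top g
  refine spanned_induction (p := fun g => ∀ x, (letter g x).val = (letter g 0).val ^^^ x.val)
    ?_ ?_ hg x
  · intro x; simp [(wreath_one _).1]
  · intro q _ g _ ih x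
    rw [(wreath_mul _ _ _).1, (wreath_mul _ _ _).1, (wreath_elt _ _).1, (wreath_elt _ _).1,
      St.out_eq_xor, St.out_eq_xor, ih x, Nat.xor_assoc]

/-- The portrait of an element, truncated to the first `n` levels. -/
noncomputable def portrait : ℕ → Γ → Tree
  | 0, _ => .leaf
  | n + 1, g => .node (letter g 0).val (portrait n (sec g 0)) (portrait n (sec g 1))
      (portrait n (sec g 2)) (portrait n (sec g 3))

theorem portrait_elt (n : ℕ) (q : St) : portrait n q.elt = q.tree n := by
  induction n generalizing q with
  | zero => rfl
  | succ n ih =>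
    simp only [portrait, St.tree, wreath_elt, St.out_eq_xor, ih, St.next_eq_step]
    simp

theorem portrait_mul (n : ℕ) (g h : Γ) :
    portrait n (g * h) = Tree.mul (portrait n g) (portrait n h) := by
  induction n generalizing g h with
  | zero => rfl
  | succ n ih =>
    have e : ∀ x : X, (letter h x).val = (letter h 0).val ^^^ x.val := letter_val h
    have e' : (letter g (letter h 0)).val = (letter g 0).val ^^^ (letter h 0).val :=
      letter_val g _
    simp only [portrait, wreath_mul, ih, e']
    have f : ∀ {x : X} (y z : X), letter h 0 = z → z.val ^^^ x.val = y.val → letter h x = y :=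
      fun y z h1 h2 => Fin.ext (by rw [e, h1, h2])
    generalize hz : letter h 0 = z
    fin_cases z
    · rw [f 1 _ hz rfl, f 2 _ hz rfl, f 3 _ hz rfl]; simp only [Tree.mul]; simp
    · rw [f 0 _ hz rfl, f 3 _ hz rfl, f 2 _ hz rfl]; simp only [Tree.mul]; simp
    · rw [f 3 _ hz rfl, f 0 _ hz rfl, f 1 _ hz rfl]; simp only [Tree.mul]; simp
    · rw [f 2 _ hz rfl, f 1 _ hz rfl, f 0 _ hz rfl]; simp only [Tree.mul]; simp

theorem Tree.eq_of_beq {s t : Tree} (h : Tree.beq s t = true) : s = t := by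
  induction s generalizing t with
  | leaf => cases t with
    | leaf => rfl
    | node => exact absurd h Bool.false_ne_true
  | node v s₀ s₁ s₂ s₃ i₀ i₁ i₂ i₃ => cases t with
    | leaf => exact absurd h Bool.false_ne_true
    | node w t₀ t₁ t₂ t₃ =>
      have h' : (v.beq w && (beq s₀ t₀ && (beq s₁ t₁ && (beq s₂ t₂ && beq s₃ t₃)))) = true := h
      simp only [Bool.and_eq_true] at h'
      obtain ⟨h, h₀, h₁, h₂, h₃⟩ := h'
      rw [Nat.eq_of_beq_eq_true h, i₀ h₀, i₁ h₁, i₂ h₂, i₃ h₃]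

theorem Tree.mem_of_mem {t : Tree} {l : List Tree} (h : Tree.mem t l = true) : t ∈ l := by
  obtain ⟨s, hs, h⟩ := List.any_eq_true.1 h
  exact Tree.eq_of_beq h ▸ hs

theorem Tree.mem_orbit {gens : List Tree} {t : Tree} (n : ℕ) (todo acc : List Tree)
    (h : t ∈ acc) : t ∈ orbit gens n todo acc := by
  induction n generalizing todo acc with
  | zero => exact h
  | succ n ih => cases todo with
    | nil => exact h
    | cons => exact ih _ _ (List.mem_append_right _ h)

theorem Tree.orbit_sound {gens : List Tree} {P : Tree → Prop}
    (hP : ∀ s ∈ gens, ∀ t, P t → P (mul s t)) (n : ℕ) (todo acc : List Tree)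
    (h₁ : ∀ t ∈ todo, P t) (h₂ : ∀ t ∈ acc, P t) : ∀ t ∈ orbit gens n todo acc, P t := by
  induction n generalizing todo acc with
  | zero => exact h₂
  | succ n ih => cases todo with
    | nil => exact h₂
    | cons s todo =>
      have key : ∀ l : List Tree, (∀ u ∈ l, u ∈ gens) →
          ∀ t ∈ l.foldr (fun u l => bif mem (mul u s) (l ++ acc) then l else mul u s :: l) [],
            P t := by
        intro l hl
        induction l with
        | nil => simp
        | cons u l ih =>
          intro t ht
          rw [List.foldr_cons] at ht
          cases hc : mem (mul u s) (l.foldr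
            (fun u l => bif mem (mul u s) (l ++ acc) then l else mul u s :: l) [] ++ acc) with
          | true =>
            rw [hc] at ht
            exact ih (fun v hv => hl v (List.mem_cons_of_mem _ hv)) t ht
          | false =>
            rw [hc, cond_false, List.mem_cons] at ht
            rcases ht with rfl | ht
            · exact hP u (hl u List.mem_cons_self) s (h₁ s List.mem_cons_self)
            · exact ih (fun v hv => hl v (List.mem_cons_of_mem _ hv)) t ht
      have hnew := key gens fun _ => id
      refine ih _ _ (fun t ht => ?_) (fun t ht => ?_)
      · rcases List.mem_append.1 ht with ht | ht
        exacts [h₁ t (List.mem_cons_of_mem _ ht), hnew t ht]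
      · rcases List.mem_append.1 ht with ht | ht
        exacts [hnew t ht, h₂ t ht]

theorem exists_of_mem_image {l : List St} {t : Tree} (h : t ∈ image l) :
    ∃ g ∈ spanned {q | q ∈ l}, portrait 4 g = t := by
  have h1 : ∀ t ∈ [St.tree 4 .one], ∃ g ∈ spanned {q | q ∈ l}, portrait 4 g = t := by
    intro t ht
    rw [List.mem_singleton.1 ht, ← portrait_elt]
    exact ⟨1, one_mem _, rfl⟩
  refine Tree.orbit_sound (P := fun t => ∃ g ∈ spanned {q | q ∈ l}, portrait 4 g = t)
    ?_ 100 _ _ h1 h1 t h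
  rintro s hs _ ⟨g, hg, rfl⟩
  obtain ⟨q, hq, rfl⟩ := List.mem_map.1 hs
  exact ⟨q.elt * g, mul_mem (elt_mem_spanned hq) hg, by rw [portrait_mul, portrait_elt]⟩

theorem portrait_mem_image {l : List St} (hl : ∀ s ∈ l, ∀ t ∈ image l,
    Tree.mem (Tree.mul (St.tree 4 s) t) (image l) = true) {g : Γ}
    (hg : g ∈ spanned {q | q ∈ l}) : portrait 4 g ∈ image l := by
  refine spanned_induction (p := fun g => portrait 4 g ∈ image l) ?_ ?_ hg
  · refine Tree.mem_orbit _ _ _ ?_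
    rw [← portrait_elt]
    exact List.mem_singleton_self _
  · intro q hq g _ h
    rw [portrait_mul, portrait_elt]
    exact Tree.mem_of_mem (hl q hq _ h)

/-- The subgroup generated by the states of `m`. -/
def grp (m : ℕ) : Subgroup Γ := spanned {q | has m q = true}

theorem has_land (m m' : ℕ) (q : St) : has (m &&& m') q = (has m q && has m' q) :=
  Nat.testBit_land ..

theorem grp_mono {m m' : ℕ} (h : ∀ q, has m q = true → has m' q = true) : grp m ≤ grp m' :=
  spanned_mono h

theorem grp_mono_of_land_eq {m m' : ℕ} (h : m &&& m' = m) : grp m ≤ grp m' :=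
  grp_mono fun q hq => by
    rw [← h, has_land, Bool.and_eq_true] at hq
    exact hq.2

theorem exists_of_mem_imageOf {m : ℕ} {t : Tree} (h : t ∈ imageOf m) :
    ∃ g ∈ grp m, portrait 4 g = t := by
  obtain ⟨g, hg, h⟩ := exists_of_mem_image h
  exact ⟨g, spanned_mono (fun q hq => (List.mem_filter.1 hq).2) hg, h⟩

theorem sixGroups_eq (i : Fin 6) : sixGroups i = grp (stab i) := by
  apply le_antisymm
  · have h : ∀ q : St, has (stab i) q = true → q.elt ∈ grp (stab i) := fun q hq =>
      elt_mem_spanned hq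
    fin_cases i <;> refine (Subgroup.closure_le _).2 ?_ <;>
      simp only [Set.insert_subset_iff, Set.singleton_subset_iff]
    · exact ⟨h .be (by decide), h .ga (by decide), h .b (by decide), h .c (by decide)⟩
    · exact ⟨h .al (by decide), h .ga (by decide), h .a (by decide), h .c (by decide)⟩
    · exact ⟨h .al (by decide), h .be (by decide), h .a (by decide), h .b (by decide)⟩
    · exact ⟨h .al (by decide), h .b (by decide), h .c (by decide)⟩
    · exact ⟨h .be (by decide), h .a (by decide), h .cga (by decide)⟩
    · exact ⟨h .ga (by decide), h .aal (by decide), h .bbe (by decide)⟩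
  · refine spanned_le fun q hq => ?_
    fin_cases i <;> cases q <;> first
      | exact absurd hq (by decide)
      | exact one_mem _
      | (refine Subgroup.subset_closure ?_; simp [St.elt]; done)
      | (refine mul_mem (Subgroup.subset_closure ?_) (Subgroup.subset_closure ?_) <;> simp <;> done)
      | (refine mul_mem (mul_mem (Subgroup.subset_closure ?_)
          (Subgroup.subset_closure ?_)) (Subgroup.subset_closure ?_) <;> simp)

theorem grp_le_large : grp (stab 0) ≤ spanned {q | q ∈ large} := by
  refine spanned_le fun q hq => ?_
  have h : ∀ q ∈ large, q.elt ∈ spanned {q | q ∈ large} := fun q hq => elt_mem_spanned hq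
  cases q <;> first
    | exact absurd hq (by decide)
    | exact one_mem _
    | (refine h _ ?_; simp [large]; done)
    | (refine mul_mem (h .b ?_) (h .be ?_) <;> simp [large])
    | (refine mul_mem (h .c ?_) (h .ga ?_) <;> simp [large])

theorem grp_le_small : ∀ p ∈ small, grp p.1 ≤ spanned {q | q ∈ p.2} := by
  intro p hp
  refine spanned_le fun q hq => ?_
  have h : ∀ q ∈ p.2, q.elt ∈ spanned {q | q ∈ p.2} := fun q hq => elt_mem_spanned hq
  simp only [small, List.mem_cons, List.not_mem_nil, or_false] at hp
  rcases hp with rfl | rfl | rfl | rfl | rfl <;> cases q <;> first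
    | exact absurd hq (by decide)
    | exact one_mem _
    | (refine h _ ?_; simp; done)
    | (refine mul_mem (h .b ?_) (h .be ?_) <;> simp)
    | (refine mul_mem (h .c ?_) (h .ga ?_) <;> simp)
    | (refine mul_mem (h .a ?_) (h .al ?_) <;> simp)
    | (refine mul_mem (h .al ?_) (h .c ?_) <;> simp)
    | (refine mul_mem (mul_mem (h .a ?_) (h .al ?_)) (h .ga ?_) <;> (simp; done))
    | (refine mul_mem (h .aal ?_) (h .ga ?_) <;> simp)

/-! ### Sections of the elements of the groups -/

theorem val_mem_letters (x : X) : x.val ∈ [0, 1, 2, 3] := by revert x; decide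

/-- The content of `check_child` for the letters `x : X`. -/
theorem check_child_spec {m : ℕ} (hm : m ∈ family) (x : X) :
    (child m x ∈ family ∨ child m x ∈ special) ∧ linked m x x = true ∧
    (∀ (y : X) (s : St), linked m x y = true → has m s = true →
      linked m x (s.out y) = true ∧ has (child m x) (s.next y) = true) ∧
    (∀ q, has (child m x) q = true →
      ∃ (y : X) (s : St), linked m x y = true ∧ has m s = true ∧ s.next y = q) := by
  have h := List.all_eq_true.1 (List.all_eq_true.1 check_child m hm) x.val (val_mem_letters x)
  simp only [Bool.and_eq_true, List.all_eq_true, List.any_eq_true, Bool.or_eq_true,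
    Bool.not_eq_true'] at h
  obtain ⟨⟨⟨⟨m', hm', he⟩, h2⟩, h3⟩, h4⟩ := h
  rw [Nat.eq_of_beq_eq_true he] at hm'
  refine ⟨List.mem_append.1 hm', h2, fun y s hy hs => ?_, fun q hq => ?_⟩
  · have := (h3 y.val (val_mem_letters y)).resolve_left (by simp [hy]) s s.mem_all
    rw [St.out_eq_xor, St.next_eq_step]
    exact this.resolve_left (by simp [hs])
  · obtain ⟨y, hy, h5, s, -, h6, h7⟩ := (h4 q q.mem_all).resolve_left (by simp [hq])
    have hy4 : y < 4 := by simp at hy; omega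
    exact ⟨⟨y, hy4⟩, s, h5, h6, by
      rw [St.next_eq_step]; exact St.code_injective (Nat.eq_of_beq_eq_true h7)⟩

theorem exists_of_linked {m : ℕ} {x y : X} (h : linked m x y = true) :
    ∃ s : St, has m s = true ∧ s.out x = y ∧ s.next x = .one := by
  obtain ⟨s, -, h⟩ := List.any_eq_true.1 h
  simp only [Bool.and_eq_true] at h
  refine ⟨s, h.1.1, Fin.ext ?_, St.code_injective ?_⟩
  · rw [St.out_eq_xor]; exact Nat.eq_of_beq_eq_true h.1.2
  · rw [St.next_eq_step]; exact Nat.eq_of_beq_eq_true h.2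

theorem sec_mem {m : ℕ} (hm : m ∈ family) {g : Γ} (hg : g ∈ grp m) {x y : X}
    (h : linked m x y = true) :
    linked m x (letter g y) = true ∧ sec g y ∈ grp (child m x) := by
  refine spanned_induction (p := fun g => ∀ y : X, linked m x y = true →
    linked m x (letter g y) = true ∧ sec g y ∈ grp (child m x)) ?_ ?_ hg y h
  · intro y h
    rw [(wreath_one y).1, (wreath_one y).2]
    exact ⟨h, one_mem _⟩
  · intro s hs g _ ih y h
    obtain ⟨h1, h2⟩ := ih y h
    obtain ⟨h3, h4⟩ := (check_child_spec hm x).2.2.1 _ s h1 hs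
    rw [(wreath_mul _ _ _).1, (wreath_mul _ _ _).2, (wreath_elt _ _).1, (wreath_elt _ _).2]
    exact ⟨h3, mul_mem (elt_mem_spanned h4) h2⟩

theorem sec_mem_self {m : ℕ} (hm : m ∈ family) {g : Γ} (hg : g ∈ grp m) (x : X) :
    sec g x ∈ grp (child m x) :=
  (sec_mem hm hg (check_child_spec hm x).2.1).2

theorem has_one {m : ℕ} (hm : m ∈ family) : has m .one = true := by
  have h := List.all_eq_true.1 check_lab m hm
  rw [Bool.and_eq_true] at h
  exact h.1

theorem exists_lab_eq {m : ℕ} (hm : m ∈ family) {g : Γ} (hg : g ∈ grp m) :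
    ∃ s : St, has m s = true ∧ s.lab = (letter g 0).val := by
  refine spanned_induction (p := fun g => ∃ s : St, has m s = true ∧ s.lab = (letter g 0).val)
    ⟨.one, has_one hm, ?_⟩ ?_ hg
  · rw [(wreath_one _).1]; rfl
  · rintro s hs g _ ⟨t, ht, e⟩
    have h := List.all_eq_true.1 check_lab m hm
    simp only [Bool.and_eq_true, List.all_eq_true, List.any_eq_true, Bool.or_eq_true,
      Bool.not_eq_true'] at h
    obtain ⟨u, -, hu, e'⟩ := ((h.2 s s.mem_all t t.mem_all).resolve_left
      (by simpa using hs)).resolve_left (by simpa using ht)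
    refine ⟨u, hu, ?_⟩
    rw [Nat.eq_of_beq_eq_true e', e, (wreath_mul _ _ _).1, (wreath_elt _ _).1, St.out_eq_xor]

/-! ### The special groups -/

theorem elt_bbe_mul_be : St.bbe.elt * St.be.elt = St.b.elt :=
  show Γ.b * Γ.be * Γ.be = Γ.b by
    rw [mul_assoc, show Γ.be * Γ.be = 1 from St.be.elt_mul_self, mul_one]

theorem elt_be_mul_bbe : St.be.elt * St.bbe.elt = St.b.elt := by
  rw [← St.elt_inv .be, ← St.elt_inv .bbe, ← mul_inv_rev, elt_bbe_mul_be, St.elt_inv]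

theorem elt_b_mul_be : St.b.elt * St.be.elt = St.bbe.elt := rfl

theorem elt_be_mul_b : St.be.elt * St.b.elt = St.bbe.elt := by
  rw [← St.elt_inv .be, ← St.elt_inv .b, ← mul_inv_rev, elt_b_mul_be, St.elt_inv]

theorem eq_of_wreath {g h : Γ} (h1 : ∀ x, letter g x = letter h x) (h2 : ∀ x, sec g x = sec h x) :
    g = h :=
  Subtype.ext (Equiv.ext fun v => by
    cases v with
    | nil => rw [apply_nil, apply_nil]
    | cons x v => rw [apply_cons, apply_cons, h1, h2])

theorem special_comm : St.alc.elt * St.aalga.elt = St.aalga.elt * St.alc.elt := by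
  have one_mul' : ∀ g : Γ, St.one.elt * g = g := one_mul
  have mul_one' : ∀ g : Γ, g * St.one.elt = g := mul_one
  apply eq_of_wreath <;> intro x
  · simp only [wreath_mul, wreath_elt]
    revert x; decide
  · simp only [wreath_mul, wreath_elt]
    fin_cases x <;> simp [St.out, St.next, one_mul', mul_one', elt_bbe_mul_be, elt_be_mul_bbe,
      elt_b_mul_be, elt_be_mul_b]

theorem mem_special {m : ℕ} (hm : m ∈ special) {q : St} (hq : has m q = true) :
    q = .one ∨ q = .aalga ∨ q = .alc := by
  simp only [special, List.mem_cons, List.not_mem_nil, or_false] at hm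
  rcases hm with rfl | rfl | rfl <;> cases q <;> simp <;> exact absurd hq (by decide)

/-- A special group consists of its states and, if it contains both involutions, of their
product. -/
theorem special_cases {m : ℕ} (hm : m ∈ special) {g : Γ} (hg : g ∈ grp m) :
    (∃ s : St, has m s = true ∧ s.elt = g) ∨
      has m .aalga = true ∧ has m .alc = true ∧ g = St.aalga.elt * St.alc.elt := by
  have h1 : has m .one = true := by
    simp only [special, List.mem_cons, List.not_mem_nil, or_false] at hm
    rcases hm with rfl | rfl | rfl <;> decide
  have one_mul' : ∀ g : Γ, St.one.elt * g = g := one_mul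
  have mul_one' : ∀ g : Γ, g * St.one.elt = g := mul_one
  refine spanned_induction (p := fun g => (∃ s : St, has m s = true ∧ s.elt = g) ∨
    has m .aalga = true ∧ has m .alc = true ∧ g = St.aalga.elt * St.alc.elt)
    (Or.inl ⟨.one, h1, rfl⟩) ?_ hg
  rintro q hq g - (⟨s, hs, rfl⟩ | ⟨hp, hr, rfl⟩)
  · rcases mem_special hm hq with rfl | rfl | rfl <;>
      rcases mem_special hm hs with rfl | rfl | rfl
    · exact Or.inl ⟨_, hq, rfl⟩
    · exact Or.inl ⟨_, hs, rfl⟩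
    · exact Or.inl ⟨_, hs, rfl⟩
    · exact Or.inl ⟨_, hq, rfl⟩
    · exact Or.inl ⟨_, h1, (St.elt_mul_self _).symm⟩
    · exact Or.inr ⟨hq, hs, rfl⟩
    · exact Or.inl ⟨_, hq, (mul_one' _).symm⟩
    · exact Or.inr ⟨hs, hq, special_comm⟩
    · exact Or.inl ⟨_, h1, (St.elt_mul_self _).symm⟩
  · rcases mem_special hm hq with rfl | rfl | rfl
    · exact Or.inr ⟨hp, hr, one_mul' _⟩
    · exact Or.inl ⟨_, hr, by rw [← mul_assoc, St.elt_mul_self, one_mul]⟩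
    · exact Or.inl ⟨_, hp, by rw [← special_comm, ← mul_assoc, St.elt_mul_self, one_mul]⟩

theorem eq_one_of_mem_special {m : ℕ} (hm : m ∈ special) {g : Γ} (hg : g ∈ grp m)
    (h : letter g 0 = 0) : g = 1 := by
  rcases special_cases hm hg with ⟨s, hs, rfl⟩ | ⟨-, -, rfl⟩
  · rcases mem_special hm hs with rfl | rfl | rfl
    · rfl
    · rw [(wreath_elt _ _).1] at h; exact absurd h (by decide)
    · rw [(wreath_elt _ _).1] at h; exact absurd h (by decide)
  · rw [(wreath_mul _ _ _).1, (wreath_elt _ _).1, (wreath_elt _ _).1] at h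
    exact absurd h (by decide)

/-! ### Elements that are trivial on the first levels -/

/-- `g` acts trivially on the words of length `n`. -/
def TrivialTo : ℕ → Γ → Prop
  | 0, _ => True
  | n + 1, g => letter g 0 = 0 ∧ ∀ x, TrivialTo n (sec g x)

theorem trivialTo_one (n : ℕ) : TrivialTo n 1 := by
  induction n with
  | zero => trivial
  | succ n ih => exact ⟨(wreath_one 0).1, fun x => by rw [(wreath_one x).2]; exact ih⟩

theorem TrivialTo.of_succ {n : ℕ} {g : Γ} (h : TrivialTo (n + 1) g) : TrivialTo n g := by
  induction n generalizing g with
  | zero => trivial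
  | succ n ih => exact ⟨h.1, fun x => ih (h.2 x)⟩

theorem triv_portrait {n k : ℕ} (h : n ≤ k) (g : Γ) :
    triv n (portrait k g) = true ↔ TrivialTo n g := by
  induction k generalizing n g with
  | zero => obtain rfl : n = 0 := by omega
            exact iff_of_true rfl trivial
  | succ k ih =>
    cases n with
    | zero => exact iff_of_true rfl trivial
    | succ n =>
      have ih := fun x => ih (Nat.le_of_succ_le_succ h) (sec g x)
      change ((letter g 0).val.beq 0 && (triv n (portrait k (sec g 0)) &&
        (triv n (portrait k (sec g 1)) && (triv n (portrait k (sec g 2)) &&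
          triv n (portrait k (sec g 3)))))) = true ↔ letter g 0 = 0 ∧ ∀ x, TrivialTo n (sec g x)
      simp only [Bool.and_eq_true, ih, Fin.forall_fin_succ, Fin.forall_fin_zero, Nat.beq_eq,
        Fin.ext_iff]
      simp

theorem triv_portrait_one (n k : ℕ) : triv n (portrait k 1) = true := by
  induction k generalizing n with
  | zero => rfl
  | succ k ih =>
    cases n with
    | zero => rfl
    | succ n =>
      simp only [portrait, wreath_one]
      change ((0 : ℕ).beq 0 && (triv n (portrait k 1) && (triv n (portrait k 1) &&
        (triv n (portrait k 1) && triv n (portrait k 1))))) = true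
      rw [ih]
      rfl

theorem eq_one_of_trivialTo {g : Γ} (h : ∀ n, TrivialTo n g) : g = 1 := by
  refine Subtype.ext (Equiv.ext fun v => ?_)
  change (g : Equiv.Perm (List X)) v = v
  induction v generalizing g with
  | nil => exact apply_nil g
  | cons x v ih =>
    rw [apply_cons, ih fun n => (h (n + 1)).2 x]
    have : letter g x = x := Fin.ext (by rw [letter_val, (h 1).1]; simp)
    rw [this]

theorem trivialTo_of_portrait_eq {g d : Γ} {k : ℕ} (h : portrait k g = portrait k d) :
    TrivialTo k (g * d⁻¹) := by
  rw [← triv_portrait le_rfl, portrait_mul, h, ← portrait_mul, mul_inv_cancel,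
    triv_portrait le_rfl]
  exact trivialTo_one k

/-! ### Intersections of the groups -/

theorem small_mem_family : ∀ p ∈ small, p.1 ∈ family := by decide +kernel

theorem stab_mem_family : ∀ i, stab i ∈ family := by decide +kernel

/-- The content of `check_small`, for elements of the groups. -/
theorem check_small_spec {p : ℕ × List St} (hp : p ∈ small) :
    (∀ g ∈ grp p.1, portrait 4 g ∈ image p.2) ∧
    (∀ t ∈ image p.2, triv 3 t = true → triv 4 t = true) ∧
    ∀ j k, p.1 &&& stab j &&& stab k = p.1 ∨ ∀ t ∈ image p.2, compat (stab j) t = true →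
      compat (stab k) t = true → t ∈ imageOf (p.1 &&& stab j &&& stab k) := by
  have h := List.all_eq_true.1 check_small p hp
  simp only [Bool.and_eq_true, List.all_eq_true, Bool.or_eq_true, Bool.not_eq_true'] at h
  obtain ⟨⟨h1, h2⟩, h3⟩ := h
  refine ⟨fun g hg => portrait_mem_image h1 (grp_le_small p hp hg),
    fun t ht h => (h2 t ht).resolve_left (by simp [h]), fun j k => ?_⟩
  refine (h3 j (List.mem_finRange j) k (List.mem_finRange k)).imp Nat.eq_of_beq_eq_true ?_
  cases hm : p.1 &&& stab j &&& stab k with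
  | zero => exact fun h => absurd h Bool.false_ne_true
  | succ r =>
    intro h t ht hj hk
    have h : ((image p.2).all fun t => !compat (stab j) t || (!compat (stab k) t ||
      Tree.mem t (imageOf (r + 1)))) = true := h
    simp only [List.all_eq_true, Bool.or_eq_true, Bool.not_eq_true'] at h
    exact Tree.mem_of_mem (((h t ht).resolve_left (by simp [hj])).resolve_left (by simp [hk]))

/-- An element of a group in `small` that is trivial on three levels is trivial on four levels, so
its sections are trivial on three levels; these lie in groups of the same kind. -/
theorem small_faithful {p : ℕ × List St} (hp : p ∈ small) {g : Γ} (hg : g ∈ grp p.1)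
    (h : TrivialTo 3 g) : g = 1 := by
  suffices key : ∀ n g, ((∃ p ∈ small, g ∈ grp p.1) ∨ ∃ m ∈ special, g ∈ grp m) →
      TrivialTo 3 g → TrivialTo (n + 3) g by
    exact eq_one_of_trivialTo fun n => (key n g (Or.inl ⟨p, hp, hg⟩) h).of_succ.of_succ.of_succ
  intro n
  induction n with
  | zero => exact fun g _ h => h
  | succ n ih =>
    rintro g (⟨p, hp, hg⟩ | ⟨m, hm, hg⟩) h
    · have h4 : TrivialTo 4 g := (triv_portrait le_rfl g).1
        ((check_small_spec hp).2.1 _ ((check_small_spec hp).1 g hg)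
          ((triv_portrait (by omega) g).2 h))
      refine ⟨h4.1, fun x => ih _ ?_ (h4.2 x)⟩
      have hs := sec_mem_self (small_mem_family p hp) hg x
      have hc := List.all_eq_true.1 (List.all_eq_true.1 check_small_child p hp) x.val (val_mem_letters x)
      simp only [Bool.or_eq_true, List.any_eq_true] at hc
      rcases hc with ⟨m, hm, e⟩ | ⟨p', hp', e⟩
      · exact Or.inr ⟨m, hm, Nat.eq_of_beq_eq_true e ▸ hs⟩
      · exact Or.inl ⟨p', hp', grp_mono_of_land_eq (Nat.eq_of_beq_eq_true e) hs⟩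
    · rw [eq_one_of_mem_special hm hg h.1]
      exact trivialTo_one _

/-- The condition `compat` is necessary for membership in a group. -/
theorem compat_portrait {m : ℕ} (hm : m ∈ family ∨ m ∈ special) {g : Γ} (hg : g ∈ grp m) (n : ℕ) :
    compat m (portrait n g) = true := by
  induction n generalizing m g with
  | zero => rfl
  | succ n ih =>
    change (bif special.any m.beq then !(letter g 0).val.beq 0 || triv 4 (portrait (n + 1) g) else
      (St.all.any fun s => has m s && s.lab.beq (letter g 0).val) &&
      (pass (child m 0) (fun m => compat m (portrait n (sec g 0))) &&
      (pass (child m 1) (fun m => compat m (portrait n (sec g 1))) &&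
      (pass (child m 2) (fun m => compat m (portrait n (sec g 2))) &&
      pass (child m 3) (fun m => compat m (portrait n (sec g 3))))))) = true
    cases hs : special.any m.beq with
    | true =>
      obtain ⟨m', hm', e⟩ := List.any_eq_true.1 hs
      obtain rfl := Nat.eq_of_beq_eq_true e
      rw [cond_true, Bool.or_eq_true, Bool.not_eq_true']
      by_cases h : letter g 0 = 0
      · right
        rw [eq_one_of_mem_special hm' hg h]
        exact triv_portrait_one _ _
      · left
        exact Bool.eq_false_iff.2 fun h' => h (Fin.ext (Nat.eq_of_beq_eq_true h'))
    | false =>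
      have hm : m ∈ family := hm.resolve_right fun h =>
        absurd (List.any_eq_true.2 ⟨m, h, Nat.beq_refl m⟩) (by simp [hs])
      have key : ∀ x : X, pass (child m x) (fun m => compat m (portrait n (sec g x))) = true := by
        intro x
        have hc := (check_child_spec hm x).1
        have h := ih hc (sec_mem_self hm hg x)
        cases h0 : child m x with
        | zero => exact absurd hc (by rw [h0]; decide +kernel)
        | succ r => rw [h0] at h; exact h
      obtain ⟨s, h1, h2⟩ := exists_lab_eq hm hg
      rw [cond_false]
      simp only [Bool.and_eq_true]
      exact ⟨List.any_eq_true.2 ⟨s, s.mem_all, by simp [h1, h2]⟩, key 0, key 1, key 2, key 3⟩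

/-- A group of the list `small` meets the other groups in the group that is spanned by the common
states: both sides have the same portraits, and the group is determined by the portraits. -/
theorem small_inter {p : ℕ × List St} (hp : p ∈ small) (j k : Fin 6) {g : Γ} (hg : g ∈ grp p.1)
    (hj : g ∈ grp (stab j)) (hk : g ∈ grp (stab k)) : g ∈ grp (p.1 &&& stab j &&& stab k) := by
  obtain ⟨h1, -, h3⟩ := check_small_spec hp
  rcases h3 j k with h | h
  · rwa [h]
  obtain ⟨d, hd, e⟩ := exists_of_mem_imageOf (h _ (h1 g hg)
    (compat_portrait (Or.inl (stab_mem_family j)) hj 4)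
    (compat_portrait (Or.inl (stab_mem_family k)) hk 4))
  have hd' : d ∈ grp p.1 := grp_mono (by simp +contextual [has_land]) hd
  have := small_faithful hp (mul_mem hg (inv_mem hd')) (trivialTo_of_portrait_eq e.symm).of_succ
  rwa [mul_inv_eq_one.1 this]

theorem large_inter {g : Γ} (h0 : g ∈ grp (stab 0)) (h2 : g ∈ grp (stab 2)) :
    g ∈ grp (stab 0 &&& stab 2) := by
  have h := check_large
  simp only [Bool.and_eq_true, List.all_eq_true, Bool.or_eq_true, Bool.not_eq_true'] at h
  obtain ⟨d, hd, e⟩ := exists_of_mem_imageOf (Tree.mem_of_mem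
    ((h.2 _ (portrait_mem_image h.1 (grp_le_large h0))).resolve_left
      (by simp [compat_portrait (Or.inl (stab_mem_family 2)) h2 4])))
  have hd' : d ∈ grp (stab 2) := grp_mono (by simp [has_land]) hd
  have ht := trivialTo_of_portrait_eq e.symm
  -- The sections of the elements of the third group lie in the second group.
  have : g * d⁻¹ = 1 := eq_of_wreath
    (fun x => Fin.ext (by rw [letter_val, ht.1, (wreath_one x).1]; simp)) fun x => by
      rw [(wreath_one x).2]
      have hs := sec_mem_self (stab_mem_family 2) (mul_mem h2 (inv_mem hd')) x
      have hc : ∀ x : X, child (stab 2) x &&& stab 1 = child (stab 2) x := by decide +kernel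
      exact small_faithful (p := (stab 1, [.al, .ga, .a, .c])) List.mem_cons_self
        (grp_mono_of_land_eq (hc x) hs) (ht.2 x)
  rwa [mul_inv_eq_one.1 this]

theorem sixGroups_inf (i j k : Fin 6) :
    sixGroups i ⊓ sixGroups j ⊓ sixGroups k = grp (stab i &&& stab j &&& stab k) := by
  simp only [sixGroups_eq]
  apply le_antisymm
  · rintro g ⟨⟨hi, hj⟩, hk⟩
    have key : ∀ i j k : Fin 6, i ≠ 0 → i ≠ 2 → g ∈ grp (stab i) → g ∈ grp (stab j) →
        g ∈ grp (stab k) → g ∈ grp (stab i &&& stab j &&& stab k) := by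
      intro i j k h0 h2 hi hj hk
      have : ∃ p ∈ small, p.1 = stab i := by
        fin_cases i
        · exact absurd rfl h0
        · exact ⟨_, List.mem_cons_self, rfl⟩
        · exact absurd rfl h2
        · exact ⟨(stab 3, [.al, .b, .c]), by simp [small], rfl⟩
        · exact ⟨(stab 4, [.be, .a, .cga]), by simp [small], rfl⟩
        · exact ⟨(stab 5, [.ga, .aal, .bbe]), by simp [small], rfl⟩
      obtain ⟨p, hp, e⟩ := this
      rw [← e] at hi ⊢
      exact small_inter hp j k hi hj hk
    by_cases h : i ≠ 0 ∧ i ≠ 2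
    · exact key i j k h.1 h.2 hi hj hk
    by_cases h' : j ≠ 0 ∧ j ≠ 2
    · rw [Nat.land_comm (stab i)]
      exact key j i k h'.1 h'.2 hj hi hk
    by_cases h'' : k ≠ 0 ∧ k ≠ 2
    · rw [Nat.land_comm, ← Nat.land_assoc]
      exact key k i j h''.1 h''.2 hk hi hj
    have e : ∀ i : Fin 6, ¬(i ≠ 0 ∧ i ≠ 2) → i = 0 ∨ i = 2 := by decide
    rcases e i h with rfl | rfl <;> rcases e j h' with rfl | rfl <;>
      rcases e k h'' with rfl | rfl <;>
      first
        | (refine grp_mono ?_ hi; simp [has_land]; done)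
        | exact grp_mono (by simp +contextual [has_land]) (large_inter ‹_› ‹_›)
  · refine le_inf (le_inf ?_ ?_) ?_ <;> exact grp_mono (by simp +contextual [has_land])

/-- A state that defines an element of the group generated by `m` belongs to `m`. -/
theorem has_of_elt_mem {m : ℕ} (hm : m ∈ family ∨ m ∈ special) {q : St} (hq : q.elt ∈ grp m) :
    has m q = true := by
  rcases hm with hm | hm
  · have hc := compat_portrait (Or.inl hm) hq 4
    rw [portrait_elt] at hc
    have h := List.all_eq_true.1 (List.all_eq_true.1 check_has m hm) q q.mem_all
    rw [Bool.or_eq_true, Bool.not_eq_true'] at h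
    exact h.resolve_left (by simp [hc])
  · have h := List.all_eq_true.1 check_special q q.mem_all
    simp only [Bool.and_eq_true, List.all_eq_true, Bool.or_eq_true, Bool.not_eq_true',
      ← portrait_elt, ← portrait_mul] at h
    rcases special_cases hm hq with ⟨s, hs, e⟩ | ⟨-, -, e⟩
    · have h := h.1 s (by simpa using mem_special hm hs)
      rw [← e, St.elt_mul_self, triv_portrait_one] at h
      obtain rfl := St.code_injective (Nat.eq_of_beq_eq_true (h.resolve_left (by simp)))
      exact hs
    · have h := h.2
      rw [← e, St.elt_mul_self, triv_portrait_one] at h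
      exact absurd h (by simp)

/-! ### The local structure of the spaces -/

/-- The local structure of `𝒯ₙ` at a point `z`: the set of the elements `g` such that
`z · g⁻¹ ∈ 𝒯ₙ` is a group of the family or a special group and fixes `z`, or it is contained in the
state set `𝔄`. -/
def Local (n : ℕ) (z : XiPow n) : Prop :=
  (∃ m, (m ∈ family ∨ m ∈ special) ∧ (∀ g ∈ grp m, op g • z = z) ∧
    ∀ g : Γ, op g⁻¹ • z ∈ T n → g ∈ grp m) ∨
  ∀ g : Γ, op g⁻¹ • z ∈ T n → g ∈ Aut12

theorem exists_of_mem_groupFamily {H : Subgroup Γ} (hH : H ∈ groupFamily) :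
    ∃ m ∈ family, H = grp m := by
  obtain ⟨i, j, k, rfl⟩ := hH
  refine ⟨_, ?_, sixGroups_inf i j k⟩
  rw [family, List.mem_dedup, List.mem_flatMap]
  refine ⟨i, List.mem_finRange i, List.mem_flatMap.2 ⟨j, List.mem_finRange j, ?_⟩⟩
  exact List.mem_map.2 ⟨k, List.mem_finRange k, rfl⟩

theorem local_zero {z : XiPow 0} (hz : z ∈ T 0) : Local 0 z := by
  obtain ⟨ξ, hξ, v, rfl⟩ := hz
  obtain ⟨H, hH, h1, h2⟩ := exists_stabilizer hξ
  obtain ⟨m, hm, rfl⟩ := exists_of_mem_groupFamily hH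
  have key : ∀ (g : Γ) (ξ' : Xi), op g • (tmul Γ ξ (word 0 v) : XiPow 0) = tmul Γ ξ' (1 : Γ) ↔
      op g • ξ = ξ' := by
    intro g ξ'
    refine Iff.trans (tmul_eq_iff (G := Γ) (Y := Xi) (M := Γ)) ?_
    constructor
    · rintro ⟨k, rfl, e⟩
      have e : (1 : Γ) = k * (1 * g) := e
      rw [one_mul] at e
      rw [smul_smul, ← op_mul, ← e, op_one, one_smul]
    · rintro rfl
      refine ⟨g⁻¹, by rw [op_inv, inv_smul_smul], ?_⟩
      change (1 : Γ) = g⁻¹ * (1 * g)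
      rw [one_mul, inv_mul_cancel]
  refine Or.inl ⟨m, Or.inl hm, fun g hg => (key g ξ).2 (h1 g hg), fun g hg => h2 g ?_⟩
  obtain ⟨ξ', hξ', w, e⟩ := hg
  rw [(key _ _).1 e]
  exact hξ'

theorem sec_mem_aut {g : Γ} (h : g ∈ Aut12) (x : X) : sec g x ∈ Aut12 := by
  obtain ⟨q, rfl⟩ := exists_elt_of_mem h
  rw [(wreath_elt q x).2]
  exact St.elt_mem _

/-- Letters in an orbit of a group that fixes `z` give the same point `z ⊗ x`. -/
theorem snoc_eq_of_linked {n : ℕ} {z : XiPow n} {m : ℕ} (hz : ∀ g ∈ grp m, op g • z = z)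
    {x y : X} (h : linked m x y = true) : snoc z y = snoc z x := by
  obtain ⟨s, hs, rfl, e⟩ := exists_of_linked h
  refine (snoc_eq_snoc_iff.2 ⟨s.elt, (hz _ (elt_mem_spanned hs)).symm, (wreath_elt s x).1, ?_⟩).symm
  rw [(wreath_elt s x).2, e]
  rfl

/-- The product of the two generating involutions of the special group is not in the state set,
but its sections are: at each letter, or at a letter with which the first involution identifies it,
the second involution has the same section. -/
theorem sec_special_mul (x : X) : ∃ y : X,
    (y = x ∨ St.aalga.out x = y ∧ St.aalga.next x = .one) ∧
      sec (St.aalga.elt * St.alc.elt) x = (St.alc.next y).elt := by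
  rw [(wreath_mul _ _ _).2, (wreath_elt _ _).1, (wreath_elt _ _).2, (wreath_elt _ _).2]
  fin_cases x
  · exact ⟨0, Or.inl rfl, one_mul _⟩
  · exact ⟨2, Or.inr ⟨rfl, rfl⟩, elt_be_mul_bbe⟩
  · exact ⟨1, Or.inr ⟨rfl, rfl⟩, elt_be_mul_b⟩
  · exact ⟨3, Or.inl rfl, one_mul _⟩

theorem elt_alc_next_ne_one (y : X) : (St.alc.next y).elt ≠ 1 := by
  intro h
  have h1 := (wreath_elt ((St.alc.next y).next 0) 0).1
  rw [← (wreath_elt (St.alc.next y) 0).2, h, (wreath_one 0).2, (wreath_one 0).1] at h1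
  clear h
  revert h1 y
  decide

theorem mem_special_group {m : ℕ} (hm : m ∈ special) {g : Γ} (hg : g ∈ grp m) :
    g ∈ Aut12 ∨
      has m .aalga = true ∧ has m .alc = true ∧ g = St.aalga.elt * St.alc.elt :=
  (special_cases hm hg).imp_left fun ⟨s, _, e⟩ => e ▸ s.elt_mem

/-- The set at `z ⊗ x` consists of the sections at `x` of the elements of the set at `z`. -/
theorem local_snoc {n : ℕ} {z : XiPow n} (hz : z ∈ T n) (h : Local n z) (x : X) :
    Local (n + 1) (snoc z x) := by
  have key : ∀ g : Γ, op g⁻¹ • snoc z x ∈ T (n + 1) → ∃ h : Γ, op h⁻¹ • z ∈ T n ∧ sec h x = g :=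
    fun g hg => exists_of_snoc_mem_K (mem_K_iff.2 ⟨snoc_mem hz x, hg⟩)
  rcases h with ⟨m, hm | hm, h1, h2⟩ | h
  · obtain ⟨hc, hl, -, hq⟩ := check_child_spec hm x
    refine Or.inl ⟨child m x, hc, fun g hg => ?_, fun g hg => ?_⟩
    · refine spanned_induction (p := fun g => op g • snoc z x = snoc z x) ?_ ?_ hg
      · rw [op_one, one_smul]
      · intro q hq' g _ ih
        obtain ⟨y, s, hy, hs, rfl⟩ := hq q hq'
        have hs' : s.elt ∈ grp m := elt_mem_spanned hs
        have e := snoc_smul s.elt z y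
        rw [h1 _ hs', snoc_eq_of_linked h1 hy, snoc_eq_of_linked h1 (sec_mem hm hs' hy).1,
          (wreath_elt s y).2] at e
        rw [op_mul, mul_smul, ← e, ih]
    · obtain ⟨k, hk, rfl⟩ := key g hg
      exact sec_mem_self hm (h2 k hk) x
  · refine Or.inr fun g hg => ?_
    obtain ⟨k, hk, rfl⟩ := key g hg
    rcases mem_special_group hm (h2 k hk) with h | ⟨-, -, rfl⟩
    · exact sec_mem_aut h x
    · obtain ⟨y, -, e⟩ := sec_special_mul x
      exact e ▸ St.elt_mem _
  · refine Or.inr fun g hg => ?_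
    obtain ⟨k, hk, rfl⟩ := key g hg
    exact sec_mem_aut (h k hk) x

theorem local_of_mem {n : ℕ} {z : XiPow n} (hz : z ∈ T n) : Local n z := by
  induction n with
  | zero => exact local_zero hz
  | succ n ih =>
    obtain ⟨w, hw, x, rfl⟩ := exists_of_mem_T_succ hz
    exact local_snoc hw (ih hw) x

theorem inv_eq_self_of_mem {g : Γ} (h : g ∈ Aut12) : g⁻¹ = g := by
  obtain ⟨q, rfl⟩ := exists_elt_of_mem h
  exact q.elt_inv

/-! ### The identifications and the sets `K` -/

theorem mem_K_of_fixed {n : ℕ} {z : XiPow n} (hz : z ∈ T n) {g : Γ} (h : op g • z = z) :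
    z ∈ K g n :=
  mem_K_iff.2 ⟨hz, by rwa [op_inv, inv_smul_eq_iff.2 h.symm]⟩

theorem identified_of_mem {n : ℕ} {z z' : XiPow n} (hz : z ∈ T n) (hz' : z' ∈ T n) {x x' : X}
    {g : Γ} (hg : g ∈ Aut12) (h1 : z = op g • z') (h2 : letter g x = x') (h3 : sec g x = 1) :
    Identified n (⟨z, hz⟩, x) (⟨z', hz'⟩, x') := by
  have e : op g⁻¹ • z = z' := by rw [h1, op_inv, inv_smul_smul]
  exact ⟨g, hg, h3, mem_K_iff.2 ⟨hz, e ▸ hz'⟩, e.symm, h2.symm⟩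

theorem paste_eq_iff {n : ℕ} (p q : T n × X) :
    paste n p = paste n q ↔ Relation.EqvGen (Identified n) p q := by
  constructor
  · obtain ⟨⟨z, hz⟩, x⟩ := p
    obtain ⟨⟨z', hz'⟩, x'⟩ := q
    intro e
    have e : snoc z x = snoc z' x' := congrArg Subtype.val e
    obtain ⟨h, h1, h2, h3⟩ := snoc_eq_snoc_iff.1 e
    have hT : op h⁻¹ • z ∈ T n := by rwa [h1, op_inv, inv_smul_smul]
    refine Relation.EqvGen.rel _ _ ?_
    rcases local_of_mem hz with ⟨m, hm | hm, h4, h5⟩ | h4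
    · -- the orbit of `x` consists of letters that are identified with `x` in one step
      have hh := h5 h hT
      obtain ⟨s, hs, h6, h7⟩ := exists_of_linked
        (sec_mem hm hh (check_child_spec hm x).2.1).1
      have hs' : s.elt ∈ grp m := elt_mem_spanned hs
      have hzz : z = z' := by
        have h8 := h4 h hh
        nth_rewrite 2 [h1] at h8
        exact smul_left_cancel _ h8
      refine identified_of_mem hz hz' s.elt_mem (hzz ▸ (h4 _ hs').symm)
        ((wreath_elt s x).1.trans (h6.trans h2)) ?_
      rw [(wreath_elt s x).2, h7]
      rfl
    · rcases mem_special_group hm (h5 h hT) with h6 | ⟨-, -, rfl⟩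
      · exact identified_of_mem hz hz' h6 h1 h2 h3
      · obtain ⟨y, -, e⟩ := sec_special_mul x
        exact absurd (e.symm.trans h3) (elt_alc_next_ne_one y)
    · exact identified_of_mem hz hz' (h4 h hT) h1 h2 h3
  · intro h
    induction h with
    | rel p q h =>
      obtain ⟨g, -, h1, h2, h3, h4⟩ := h
      refine Subtype.ext ?_
      change snoc p.1.1 p.2 = snoc q.1.1 q.2
      rw [h3, h4]
      refine Eq.trans ?_ (smul_inv_snoc g p.1.1 p.2)
      rw [h1, inv_one, op_one, one_smul]
    | refl p => rfl
    | symm p q _ ih => exact ih.symm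
    | trans p q r _ _ ih1 ih2 => exact ih1.trans ih2

theorem K_succ {n : ℕ} {g : Γ} (hg : g ∈ Aut12) : K g (n + 1) =
    {z | ∃ h ∈ Aut12, ∃ x : X, sec h x = g ∧ ∃ ξ ∈ K h n, z = snoc ξ x} := by
  ext z
  constructor
  · intro hz
    obtain ⟨w, hw, x, rfl⟩ := exists_of_mem_T_succ hz.1
    obtain ⟨k, hk, rfl⟩ := exists_of_snoc_mem_K hz
    rcases local_of_mem hw with ⟨m, hm | hm, h1, h2⟩ | h
    · obtain ⟨q, hq⟩ := exists_elt_of_mem hg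
      have hs := sec_mem_self hm (h2 k hk) x
      obtain ⟨hc, -, -, h3⟩ := check_child_spec hm x
      rw [← hq] at hs
      obtain ⟨y, s, hy, hs', rfl⟩ := h3 q (has_of_elt_mem hc hs)
      exact ⟨s.elt, s.elt_mem, y, (wreath_elt s y).2.trans hq, w,
        mem_K_of_fixed hw (h1 _ (elt_mem_spanned hs')), (snoc_eq_of_linked h1 hy).symm⟩
    · rcases mem_special_group hm (h2 k hk) with h | ⟨hp, hq, rfl⟩
      · exact ⟨k, h, x, rfl, w, mem_K_iff.2 ⟨hw, hk⟩, rfl⟩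
      · obtain ⟨y, hy, e⟩ := sec_special_mul x
        refine ⟨St.alc.elt, St.elt_mem _, y, (wreath_elt _ y).2.trans e.symm, w,
          mem_K_of_fixed hw (h1 _ (elt_mem_spanned hq)), ?_⟩
        rcases hy with rfl | ⟨hy, h3⟩
        · rfl
        · refine snoc_eq_snoc_iff.2 ⟨St.aalga.elt, (h1 _ (elt_mem_spanned hp)).symm,
            (wreath_elt _ x).1.trans hy, ?_⟩
          rw [(wreath_elt _ x).2, h3]
          rfl
    · exact ⟨k, h k hk, x, rfl, w, mem_K_iff.2 ⟨hw, hk⟩, rfl⟩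
  · rintro ⟨h, -, x, rfl, ξ, hξ, rfl⟩
    exact snoc_mem_K hξ x

end Pasting

theorem mainTheorem2 (n : ℕ) :
    -- `𝒯ₙ₊₁` is the quotient of `𝒯ₙ × X` by the equivalence relation that is generated
    -- by the identifications
    (Topology.IsQuotientMap (Pasting.paste n) ∧
      ∀ p q : Pasting.T n × Pasting.X,
        Pasting.paste n p = Pasting.paste n q ↔
          Relation.EqvGen (Pasting.Identified n) p q) ∧
    -- the sets `K_{g,n+1}`
    (∀ g ∈ Pasting.Aut12,
      Pasting.K g (n + 1) =
        {z | ∃ h ∈ Pasting.Aut12, ∃ x : Pasting.X, Pasting.sec h x = g ∧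
          ∃ ξ ∈ Pasting.K h n, z = Pasting.snoc ξ x}) ∧
    -- the maps `κ_{g,n+1}` from `K_{g,n+1}` to itself
    (∀ g ∈ Pasting.Aut12,
      Pasting.K g⁻¹ (n + 1) = Pasting.K g (n + 1) ∧
      ∀ h ∈ Pasting.Aut12, ∀ x : Pasting.X, Pasting.sec h x = g →
        ∀ ξ : Pasting.K h n, ∃ hz : Pasting.snoc ξ.1 x ∈ Pasting.K g (n + 1),
          (Pasting.kappa g (n + 1) ⟨Pasting.snoc ξ.1 x, hz⟩).1 =
            Pasting.snoc (Pasting.kappa h n ξ).1 (Pasting.letter h x)) := by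
  exact ⟨⟨Pasting.isQuotientMap_paste n, Pasting.paste_eq_iff⟩, fun g hg => Pasting.K_succ hg,
    fun g hg => ⟨by rw [Pasting.inv_eq_self_of_mem hg], fun h _ x e ξ => by
      subst e
      exact ⟨Pasting.snoc_mem_K ξ.2 x, Pasting.smul_inv_snoc h ξ.1 x⟩⟩⟩
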